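/- Let $n\ge 1$ and $0<\gamma\le 1$. Write $|\cdot|$ for the $\ell_\infty$ norm on $\mathbb{R}^n$. For $k\in\mathbb{Z}$ let $\mathcal{Q}_k$ be the set of dyadic cubes $\prod_{i=1}^n [m_i2^{-k},(m_i+1)2^{-k})$, $m\in\mathbb{Z}^n$. For $f\in L_2(\mathbb{R}^n)$ (complex-valued) put $$f_k=\sum_{Q\in\mathcal{Q}_k}\Big(\frac1{|Q|}\int_Q f\Big)1_Q,\qquad df_k=f_k-f_{k-1}.$$ For a positive integer $s$ let $\Omega_k$ be the smallest union of cubes of $\mathcal{Q}_k$ that contains $\operatorname{supp} df_{k+s}=\{x: df_{k+s}(x)\neq 0\}$, and let $$\Sigma_{f,s}=\bigcup_{k\in\mathbb{Z}}9\,\Omega_k,\qquad 9\,\Omega_k=\bigcup_{Q\in\mathcal{Q}_k,\ Q\subset\Omega_k}9Q,$$ where $9Q$ is the cube with the same centre as $Q$ and nine times its side length. Let $T$ be a Calderón--Zygmund operator that is bounded on $L_2(\mathbb{R}^n)$ with norm at most $1$, associated to a kernel $K$ off the diagonal, i.e. for every $\varphi\in C_c^\infty(\mathbb{R}^n)$ we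 have $T\varphi(x)=\int K(x,y)\varphi(y)\,dy$ for almost every $x\notin\operatorname{supp}\varphi$. Suppose that, for a constant $A$, whenever $x\ne y$, $$|K(x,y)|\le \frac{A}{|x-y|^{n}},$$ $$|K(x,y)-K(x',y)|\le \frac{A\,|x-x'|^\gamma}{|x-y|^{n+\gamma}}\ \text{ if } |x-x'|\le\tfrac12|x-y|,$$ $$|K(x,y)-K(x,y')|\le \frac{A\,|y-y'|^\gamma}{|x-y|^{n+\gamma}}\ \text{ if } |y-y'|\le\tfrac12|x-y|.$$ Then there is a constant $c_{n,\gamma}>0$, depending only on $n$ and $\gamma$ (and not on $s$, $f$, $T$, $K$, $A$), such that for all such $s$, $f$ and $T$ $$\Big(\int_{\mathbb{R}^n\setminus\Sigma_{f,s}}|Tf(x)|^2\,dx\Big)^{1/2}\le c_{n,\gamma}\,(1+A)\,s\,2^{-\gamma s/4}\Big(\int_{\mathbb{R}^n}|f(x)|^2\,dx\Big)^{1/2}.$$ -/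

import Mathlib

open MeasureTheory Set
open scoped ContDiff

noncomputable section

namespace PseudoLoc

/-- `ℝⁿ`, with the `ℓ_∞(n)` norm (the norm of a pi type) and Lebesgue measure. -/
abbrev Space (n : ℕ) : Type := Fin n → ℝ

/-- The complex Hilbert space `L_2(ℝⁿ)` for Lebesgue measure. -/
abbrev L2 (n : ℕ) : Type := Lp ℂ 2 (volume : Measure (Space n))

/-! ### Dyadic cubes -/

/-- The (half-open) dyadic cube of generation `k`, i.e. of side `2 ^ (-k)`, with lower corner
`2 ^ (-k) • m`. The cubes of generation `k` are these, for `m : Fin n → ℤ`. -/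
def cube {n : ℕ} (k : ℤ) (m : Fin n → ℤ) : Set (Space n) :=
  {x | ∀ i, (m i : ℝ) * (2 : ℝ) ^ (-k) ≤ x i ∧ x i < ((m i : ℝ) + 1) * (2 : ℝ) ^ (-k)}

/-- The cube `9 Q` with the same centre as the dyadic cube `Q = cube k m` and nine times
its side. -/
def cubeNine {n : ℕ} (k : ℤ) (m : Fin n → ℤ) : Set (Space n) :=
  {x | ∀ i, ((m i : ℝ) + 1 / 2 - 9 / 2) * (2 : ℝ) ^ (-k) ≤ x i ∧
    x i < ((m i : ℝ) + 1 / 2 + 9 / 2) * (2 : ℝ) ^ (-k)}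

/-- The index of the dyadic cube of generation `k` that contains `x`. -/
def cubeIndex {n : ℕ} (k : ℤ) (x : Space n) : Fin n → ℤ := fun i => ⌊x i * (2 : ℝ) ^ k⌋

theorem mem_cube_iff {n : ℕ} (k : ℤ) (m : Fin n → ℤ) (x : Space n) :
    x ∈ cube k m ↔ m = cubeIndex k x := by
  have h2 : (0 : ℝ) < (2 : ℝ) ^ k := by positivity
  have key : ∀ i, ((m i : ℝ) * (2 : ℝ) ^ (-k) ≤ x i ∧
      x i < ((m i : ℝ) + 1) * (2 : ℝ) ^ (-k)) ↔ m i = ⌊x i * (2 : ℝ) ^ k⌋ := by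
    intro i
    rw [eq_comm, Int.floor_eq_iff, zpow_neg, ← div_eq_mul_inv, ← div_eq_mul_inv,
      div_le_iff₀ h2, lt_div_iff₀ h2]
  simp only [cube, mem_ofPred_eq, key, cubeIndex, funext_iff]

/-! ### Dyadic martingales -/

/-- The conditional expectation `f_k = ∑ f_Q 1_Q` (sum over the dyadic cubes `Q` of generation
`k`, with `f_Q` the average of `f` over `Q`): its value at `x` is the average of `f` over the
cube of generation `k` containing `x`. -/
def dyadicExp {n : ℕ} (f : Space n → ℂ) (k : ℤ) (x : Space n) : ℂ :=
  ⨍ y in cube k (cubeIndex k x), f y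

/-- The martingale difference `df_k = f_k - f_{k-1}`. -/
def dyadicDiff {n : ℕ} (f : Space n → ℂ) (k : ℤ) (x : Space n) : ℂ :=
  dyadicExp f k x - dyadicExp f (k - 1) x

/-! ### The localization set -/

/-- `Ω` is a union of a family of dyadic cubes of generation `k`. -/
def IsCubeUnion {n : ℕ} (k : ℤ) (Ω : Set (Space n)) : Prop :=
  ∃ S : Set (Fin n → ℤ), Ω = ⋃ m ∈ S, cube k m

/-- The dilation `9 Ω = ⋃ 9 Q`, over the dyadic cubes `Q` of generation `k` that make up the
union `Ω` of such cubes. -/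
def dilateNine {n : ℕ} (k : ℤ) (Ω : Set (Space n)) : Set (Space n) :=
  ⋃ m ∈ {m : Fin n → ℤ | cube k m ⊆ Ω}, cubeNine k m

/-- `Ω_k`, the smallest union of dyadic cubes of generation `k` that contains the support
of `df_{k+s}`: the union of the cubes that meet this support. -/
def Omega {n : ℕ} (f : Space n → ℂ) (s : ℕ) (k : ℤ) : Set (Space n) :=
  ⋃ m ∈ {m : Fin n → ℤ | (cube k m ∩ Function.support (dyadicDiff f (k + s))).Nonempty}, cube k m

theorem isLeast_Omega {n : ℕ} (f : Space n → ℂ) (s : ℕ) (k : ℤ) :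
    IsLeast {Ω : Set (Space n) | IsCubeUnion k Ω ∧ Function.support (dyadicDiff f (k + s)) ⊆ Ω}
      (Omega f s k) := by
  refine ⟨⟨⟨_, rfl⟩, ?_⟩, ?_⟩
  · intro x hx
    have hxc : x ∈ cube k (cubeIndex k x) := (mem_cube_iff k _ x).2 rfl
    exact mem_biUnion (x := cubeIndex k x) ⟨x, hxc, hx⟩ hxc
  · rintro _ ⟨⟨S, rfl⟩, hS⟩
    refine iUnion₂_subset ?_
    rintro m ⟨x, hxm, hx⟩
    obtain ⟨m', hm', hxm'⟩ := mem_iUnion₂.1 (hS hx)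
    have : m = m' := ((mem_cube_iff k m x).1 hxm).trans ((mem_cube_iff k m' x).1 hxm').symm
    subst this
    exact subset_biUnion_of_mem (u := fun m => cube k m) hm'

/-- `Σ_{f,s} = ⋃_k 9 Ω_k`. -/
def localSet {n : ℕ} (f : Space n → ℂ) (s : ℕ) : Set (Space n) :=
  ⋃ k : ℤ, dilateNine k (Omega f s k)

/-! ### Calderón-Zygmund operators -/

/-- Size and Lipschitz smoothness conditions, with smoothness parameter `γ` and constant `A`, for
a kernel `K` off the diagonal of `ℝⁿ × ℝⁿ`. The values of `K` on the diagonal play no role. -/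
structure IsCZKernel {n : ℕ} (γ A : ℝ) (K : Space n → Space n → ℂ) : Prop where
  size : ∀ x y, x ≠ y → ‖K x y‖ ≤ A / ‖x - y‖ ^ n
  smooth_left : ∀ x x' y, x ≠ y → ‖x - x'‖ ≤ ‖x - y‖ / 2 →
    ‖K x y - K x' y‖ ≤ A * ‖x - x'‖ ^ γ / ‖x - y‖ ^ ((n : ℝ) + γ)
  smooth_right : ∀ x y y', x ≠ y → ‖y - y'‖ ≤ ‖x - y‖ / 2 →
    ‖K x y - K x y'‖ ≤ A * ‖y - y'‖ ^ γ / ‖x - y‖ ^ ((n : ℝ) + γ)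

/-- The operator `T`, bounded on `L_2(ℝⁿ)`, is associated to the kernel `K`: for every smooth
compactly supported `φ`, `T φ (x) = ∫ K(x,y) φ(y) dy` for (almost) all `x` outside the
support of `φ`. -/
def IsAssociated {n : ℕ} (T : L2 n →L[ℂ] L2 n) (K : Space n → Space n → ℂ) : Prop :=
  ∀ (φ : Space n → ℂ) (hφ : ContDiff ℝ ∞ φ) (hc : HasCompactSupport φ),
    ∀ᵐ x : Space n, x ∉ tsupport φ →
      T ((hφ.continuous.memLp_of_hasCompactSupport hc : MemLp φ 2 volume).toLp φ) x
        = ∫ y, K x y * φ y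

end PseudoLoc

end

noncomputable section

namespace PseudoLoc

open Filter Topology
open scoped ENNReal

variable {n : ℕ}

/-! ### Geometry of dyadic cubes -/

/-! The proof is by duality. Let g be Tf cut off to the complement of Σ, so that ⟨g, Tf⟩ = ‖g‖².
Expand f as the sum of the pieces F_k = df_{k+s}. Since g vanishes on 9Ω_k, the supports of g and
F_k are separated at scale 2^{-k} (`far_of_notMem_localSet`), and after truncation ⟨g, T F_k⟩ is a
genuine kernel integral (`IsAssociated.inner_eq_pairing`). As F_k has mean zero on cubes of
generation k+s-1, the smoothness of K in y gains 2^{-γs} and leaves the integrable weight P_k(x-y) =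
2^{kn}(1+2^k|x-y|)^{-n-γ} (`enorm_pairing_le_of_meanZero`).

It remains to sum over k. Expand g (up to conjugation) as g_k + Σ_{m≥1} dg_{k+m}.

For a fine piece dg_{k+m}, the kernel is smoothed in whichever variable has the finer cancellation.
This gains 2^{-γ max(s,m)} ≤ 2^{-γs/2} 2^{-γm/2}, which is summable in m
(`enorm_pairing_le_of_meanZero_of_meanZero`).

The coarse part g_k is not square summable over k, but it vanishes on the support of F_k. Hence
g_k(x) = g_k(x) - g_k(y) there, and this difference telescopes into dg_{k-i}(x) - dg_{k-i}(y), i ≥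
0. Since dg_{k-i} is constant on cubes of side 2^{i-k}, while P_k sees displacements of order
2^{-k}, the i-th term is small in weighted L_2 (`lintegral_decay_sq_sub_le`,
`weightForm_dyadicExp_le`).

The inequality ab ≤ ta² + b²/t and the Bessel inequality for martingale differences then give |⟨g,
Tf⟩| ≤ C A 2^{-γs/2} (t‖f‖² + ‖g‖²/t) for every t > 0. Optimising t yields a bound with decay
2^{-γs/2}, which is stronger than the one asserted. -/

theorem cubeIndex_eq_of_le {j k : ℤ} (hjk : j ≤ k) {x y : Space n}
    (h : cubeIndex k x = cubeIndex k y) : cubeIndex j x = cubeIndex j y := by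
  obtain ⟨d, rfl⟩ := Int.le.dest hjk
  have key : ∀ z : Space n, ∀ i, cubeIndex j z i = cubeIndex (j + d) z i / ((2 ^ d : ℕ) : ℤ) := by
    intro z i
    simp only [cubeIndex]
    rw [← Int.floor_div_natCast]
    congr 1
    rw [zpow_add₀ (by norm_num)]
    push_cast
    rw [zpow_natCast]
    field_simp
  funext i
  rw [key, key, h]

/-- The lower corner of the dyadic cube of generation `k` containing `x`. -/
def corner (k : ℤ) (x : Space n) : Space n := fun i => (cubeIndex k x i : ℝ) * (2 : ℝ) ^ (-k)

theorem cubeIndex_corner (k : ℤ) (x : Space n) : cubeIndex k (corner k x) = cubeIndex k x := by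
  funext i
  simp only [cubeIndex, corner]
  rw [mul_assoc, ← zpow_add₀ (by norm_num)]
  simp

theorem mem_cube_cubeIndex (k : ℤ) (x : Space n) : x ∈ cube k (cubeIndex k x) :=
  (mem_cube_iff k _ x).2 rfl

theorem cubeIndex_of_mem {k : ℤ} {m : Fin n → ℤ} {x : Space n} (h : x ∈ cube k m) :
    cubeIndex k x = m := ((mem_cube_iff k m x).1 h).symm

theorem norm_sub_le_of_cubeIndex_eq {k : ℤ} {x y : Space n}
    (h : cubeIndex k x = cubeIndex k y) : ‖x - y‖ ≤ (2 : ℝ) ^ (-k) := by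
  have hx := mem_cube_cubeIndex k x
  have hy := mem_cube_cubeIndex k y
  rw [h] at hx
  refine (pi_norm_le_iff_of_nonneg (by positivity)).2 fun i => ?_
  have h1 := hx i
  have h2 := hy i
  rw [Pi.sub_apply, Real.norm_eq_abs, abs_le]
  constructor <;> nlinarith

theorem norm_sub_corner_le (k : ℤ) (x : Space n) : ‖x - corner k x‖ ≤ (2 : ℝ) ^ (-k) :=
  norm_sub_le_of_cubeIndex_eq (cubeIndex_corner k x).symm

theorem cube_eq_pi (k : ℤ) (m : Fin n → ℤ) : cube k m =
    Set.pi univ fun i => Ico ((m i : ℝ) * (2 : ℝ) ^ (-k)) (((m i : ℝ) + 1) * (2 : ℝ) ^ (-k)) := by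
  ext x
  simp [cube]

theorem measurableSet_cube (k : ℤ) (m : Fin n → ℤ) : MeasurableSet (cube k m) := by
  rw [cube_eq_pi]
  exact MeasurableSet.univ_pi fun i => measurableSet_Ico

theorem volume_cube (k : ℤ) (m : Fin n → ℤ) :
    volume (cube k m) = ENNReal.ofReal ((2 : ℝ) ^ (-k)) ^ n := by
  rw [cube_eq_pi, volume_pi_pi]
  simp [Real.volume_Ico, add_mul]

theorem volume_cube_ne_zero (k : ℤ) (m : Fin n → ℤ) : volume (cube k m) ≠ 0 := by
  rw [volume_cube]
  exact pow_ne_zero _ (by simp; positivity)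

theorem volume_cube_ne_top (k : ℤ) (m : Fin n → ℤ) : volume (cube k m) ≠ ⊤ := by
  rw [volume_cube]
  exact ENNReal.pow_ne_top ENNReal.ofReal_ne_top

theorem volume_real_cube_ne_zero (k : ℤ) (m : Fin n → ℤ) : volume.real (cube k m) ≠ 0 :=
  ENNReal.toReal_ne_zero.2 ⟨volume_cube_ne_zero k m, volume_cube_ne_top k m⟩

theorem pairwise_disjoint_cube (k : ℤ) :
    Pairwise (Function.onFun Disjoint fun m : Fin n → ℤ => cube k m) := by
  intro m m' hne
  refine Set.disjoint_left.2 fun x hx hx' => hne ?_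
  rw [← cubeIndex_of_mem hx, cubeIndex_of_mem hx']

theorem iUnion_cube (k : ℤ) : ⋃ m : Fin n → ℤ, cube k m = univ :=
  eq_univ_of_forall fun x => mem_iUnion.2 ⟨_, mem_cube_cubeIndex k x⟩

theorem measurable_cubeIndex (k : ℤ) : Measurable (cubeIndex k : Space n → Fin n → ℤ) :=
  measurable_pi_lambda _ fun i => Int.measurable_floor.comp ((measurable_pi_apply i).mul_const _)

theorem measurable_corner (k : ℤ) : Measurable (corner k : Space n → Space n) :=
  (measurable_of_countable fun m : Fin n → ℤ => fun i => (m i : ℝ) * (2 : ℝ) ^ (-k)).comp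
    (measurable_cubeIndex k)

theorem lintegral_eq_tsum_cube (k : ℤ) (u : Space n → ℝ≥0∞) :
    ∫⁻ x, u x = ∑' m : Fin n → ℤ, ∫⁻ x in cube k m, u x := by
  rw [← setLIntegral_univ, ← iUnion_cube k,
    lintegral_iUnion (measurableSet_cube k) (pairwise_disjoint_cube k)]

/-! ### Functions constant on dyadic cubes and functions of vanishing mean on them -/

/-- `h` is constant on each dyadic cube of generation `k`. -/
def CubeConst {β : Type*} (k : ℤ) (h : Space n → β) : Prop :=
  ∀ x y, cubeIndex k x = cubeIndex k y → h x = h y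

/-- `F` has vanishing integral over each dyadic cube of generation `k`. -/
def MeanZero (k : ℤ) (F : Space n → ℂ) : Prop := ∀ m : Fin n → ℤ, ∫ x in cube k m, F x = 0

theorem CubeConst.mono {β : Type*} {j k : ℤ} (hjk : j ≤ k) {h : Space n → β}
    (hh : CubeConst j h) : CubeConst k h :=
  fun x y hxy => hh x y (cubeIndex_eq_of_le hjk hxy)

theorem CubeConst.corner_eq {β : Type*} {k : ℤ} {h : Space n → β} (hh : CubeConst k h)
    (x : Space n) : h (corner k x) = h x := hh _ _ (cubeIndex_corner k x)

theorem CubeConst.measurable {β : Type*} [MeasurableSpace β] {k : ℤ} {h : Space n → β}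
    (hh : CubeConst k h) : Measurable h := by
  have : h = (fun m : Fin n → ℤ => h fun i => (m i : ℝ) * (2 : ℝ) ^ (-k)) ∘ cubeIndex k := by
    funext x
    exact (hh.corner_eq x).symm
  rw [this]
  exact (measurable_of_countable _).comp (measurable_cubeIndex k)

theorem CubeConst.comp_corner {β : Type*} (k : ℤ) (h : Space n → β) :
    CubeConst k fun x => h (corner k x) := by
  intro x y hxy
  have : corner k x = corner k y := by
    funext i
    simp [corner, hxy]
  simp only [this]

theorem MeanZero.integral_mul_eq_zero {k : ℤ} {F h : Space n → ℂ} (hF : MeanZero k F)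
    (hh : CubeConst k h) : ∫ x, h x * F x = 0 := by
  by_cases hi : Integrable (fun x => h x * F x)
  · rw [← setIntegral_univ, ← iUnion_cube k, integral_iUnion (measurableSet_cube k)
      (pairwise_disjoint_cube k) hi.integrableOn]
    refine (tsum_congr fun m => ?_).trans tsum_zero
    rcases (cube k m).eq_empty_or_nonempty with he | ⟨z, hz⟩
    · simp [he]
    · rw [setIntegral_congr_fun (g := fun x => h z * F x) (measurableSet_cube k m)
        fun x hx => by
          simp only
          rw [hh x z ((cubeIndex_of_mem hx).trans (cubeIndex_of_mem hz).symm)],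
        integral_const_mul, hF m, mul_zero]
  -- The integral of a non-integrable function is 0 by convention, so no integrability has to be
  -- assumed.
  · exact integral_undef hi

theorem MeanZero.mul {k : ℤ} {F h : Space n → ℂ} (hF : MeanZero k F)
    (hh : CubeConst k h) : MeanZero k fun x => h x * F x := by
  intro m
  have h1 : CubeConst k fun x => (cube k m).indicator h x := by
    intro x y hxy
    have : x ∈ cube k m ↔ y ∈ cube k m := by rw [mem_cube_iff, mem_cube_iff, hxy]
    by_cases hx : x ∈ cube k m
    · simp [hx, this.1 hx, hh x y hxy]
    · simp [hx, mt this.2 hx]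
  rw [← integral_indicator (measurableSet_cube k m), ← hF.integral_mul_eq_zero h1]
  congr 1
  funext x
  by_cases hx : x ∈ cube k m <;> simp [hx]

/-- The cubes of generation `k` containing `x` and `y` differ by at least five steps in one
coordinate. -/
def Far (k : ℤ) (x y : Space n) : Prop := ∃ i, 5 ≤ |cubeIndex k x i - cubeIndex k y i|

theorem Far.symm {k : ℤ} {x y : Space n} (h : Far k x y) : Far k y x := by
  obtain ⟨i, hi⟩ := h
  exact ⟨i, by rwa [abs_sub_comm]⟩

theorem Far.congr_left {k : ℤ} {x x' y : Space n} (h : Far k x y)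
    (hx : cubeIndex k x = cubeIndex k x') : Far k x' y := by
  obtain ⟨i, hi⟩ := h
  exact ⟨i, by rwa [← hx]⟩

theorem Far.ne_index {k : ℤ} {x y : Space n} (h : Far k x y) : cubeIndex k x ≠ cubeIndex k y := by
  rintro he
  obtain ⟨i, hi⟩ := h
  simp [he] at hi

/-- Indices five apart leave four full intervals in between. The resulting distance leaves room to
move either point inside its cube and stay within the range of the smoothness conditions. -/
theorem Far.le_norm {k : ℤ} {x y : Space n} (h : Far k x y) : 4 * (2 : ℝ) ^ (-k) ≤ ‖x - y‖ := by
  obtain ⟨i, hi⟩ := h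
  refine le_trans ?_ (norm_le_pi_norm (x - y) i)
  have h1 := mem_cube_cubeIndex k x i
  have h2 := mem_cube_cubeIndex k y i
  have hp : (0 : ℝ) < (2 : ℝ) ^ (-k) := by positivity
  have hi' : (5 : ℝ) ≤ |(cubeIndex k x i : ℝ) - cubeIndex k y i| := by exact_mod_cast hi
  rw [Pi.sub_apply, Real.norm_eq_abs, le_abs]
  rcases le_abs.1 hi' with h | h
  · left; nlinarith
  · right; nlinarith

/-- 9Q is made of the cubes whose index differs from that of Q by at most 4 in every coordinate;
this is where the 5 in `Far` comes from. -/
theorem far_of_notMem_cubeNine {k : ℤ} {x y : Space n}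
    (h : x ∉ cubeNine k (cubeIndex k y)) : Far k x y := by
  simp only [cubeNine, mem_ofPred_eq, not_forall] at h
  obtain ⟨i, hi⟩ := h
  refine ⟨i, ?_⟩
  have h1 := mem_cube_cubeIndex k x i
  have hp : (0 : ℝ) < (2 : ℝ) ^ (-k) := by positivity
  by_contra hlt
  rw [not_le, abs_lt] at hlt
  apply hi
  have ha : (cubeIndex k y i : ℝ) - 4 ≤ cubeIndex k x i := by
    have : cubeIndex k y i - 4 ≤ cubeIndex k x i := by omega
    exact_mod_cast this
  have hb : (cubeIndex k x i : ℝ) + 1 ≤ cubeIndex k y i + 5 := by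
    have : cubeIndex k x i + 1 ≤ cubeIndex k y i + 5 := by omega
    exact_mod_cast this
  constructor
  · refine le_trans ?_ h1.1
    gcongr; linarith
  · refine lt_of_lt_of_le h1.2 ?_
    gcongr ?_ * _; linarith

theorem far_of_notMem_localSet {f : Space n → ℂ} {s : ℕ} {k : ℤ} {x y : Space n}
    (hx : x ∉ localSet f s) (hy : dyadicDiff f (k + s) y ≠ 0) : Far k x y := by
  refine far_of_notMem_cubeNine fun hmem => hx ?_
  refine mem_iUnion.2 ⟨k, mem_iUnion₂.2 ⟨cubeIndex k y, ?_, hmem⟩⟩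
  exact subset_biUnion_of_mem (u := fun m => cube k m)
    (show cubeIndex k y ∈ {m | (cube k m ∩ _).Nonempty} from ⟨y, mem_cube_cubeIndex k y, hy⟩)

theorem measurableSet_localSet (f : Space n → ℂ) (s : ℕ) : MeasurableSet (localSet f s) := by
  refine MeasurableSet.iUnion fun k => MeasurableSet.biUnion (to_countable _) fun m _ => ?_
  have : cubeNine k m = Set.pi univ fun i => Ico (((m i : ℝ) + 1 / 2 - 9 / 2) * (2 : ℝ) ^ (-k))
      (((m i : ℝ) + 1 / 2 + 9 / 2) * (2 : ℝ) ^ (-k)) := by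
    ext x
    simp [cubeNine]
  rw [this]
  exact MeasurableSet.univ_pi fun i => measurableSet_Ico

/-! ### Dyadic conditional expectations -/

/-- The square of the `L_2` norm, as an extended nonnegative number. -/
def sqNorm (f : Space n → ℂ) : ℝ≥0∞ := ∫⁻ x, ‖f x‖ₑ ^ 2

theorem integrableOn_cube {f : Space n → ℂ} (hf : MemLp f 2) (k : ℤ) (m : Fin n → ℤ) :
    IntegrableOn f (cube k m) := by
  have : IsFiniteMeasure (volume.restrict (cube k m)) :=
    ⟨by simpa using (volume_cube_ne_top k m).lt_top⟩
  exact (hf.restrict (cube k m)).integrable (by norm_num)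

theorem cubeConst_dyadicExp (f : Space n → ℂ) (k : ℤ) : CubeConst k (dyadicExp f k) := by
  intro x y h
  simp only [dyadicExp, h]

theorem dyadicExp_of_mem {f : Space n → ℂ} {k : ℤ} {m : Fin n → ℤ} {x : Space n}
    (hx : x ∈ cube k m) : dyadicExp f k x = ⨍ y in cube k m, f y := by
  rw [dyadicExp, cubeIndex_of_mem hx]

theorem setIntegral_dyadicExp (f : Space n → ℂ) (k : ℤ) (m : Fin n → ℤ) :
    ∫ x in cube k m, dyadicExp f k x = ∫ x in cube k m, f x := by
  rw [setIntegral_congr_fun (g := fun _ => ⨍ y in cube k m, f y) (measurableSet_cube k m)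
    fun x hx => dyadicExp_of_mem hx, setIntegral_const, setAverage_eq, smul_smul,
    mul_inv_cancel₀ (volume_real_cube_ne_zero k m), one_smul]

theorem dyadicExp_of_cubeConst {h : Space n → ℂ} {k : ℤ} (hh : CubeConst k h) :
    dyadicExp h k = h := by
  funext x
  rw [dyadicExp, setAverage_eq, setIntegral_congr_fun (g := fun _ => h x)
    (measurableSet_cube k _) fun y hy => hh y x (cubeIndex_of_mem hy), setIntegral_const,
    smul_smul, inv_mul_cancel₀ (volume_real_cube_ne_zero k _), one_smul]

theorem MeanZero.anti {j k : ℤ} (hjk : j ≤ k) {F : Space n → ℂ} (hF : MeanZero k F) :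
    MeanZero j F := by
  intro m
  have h1 : CubeConst k ((cube j m).indicator fun _ => (1 : ℂ)) := by
    refine CubeConst.mono hjk fun x y hxy => ?_
    have : x ∈ cube j m ↔ y ∈ cube j m := by rw [mem_cube_iff, mem_cube_iff, hxy]
    by_cases hx : x ∈ cube j m
    · simp [hx, this.1 hx]
    · simp [hx, mt this.2 hx]
  rw [← integral_indicator (measurableSet_cube j m), ← hF.integral_mul_eq_zero h1]
  congr 1
  funext x
  by_cases hx : x ∈ cube j m <;> simp [hx]

theorem setLIntegral_enorm_dyadicExp_le (f : Space n → ℂ) (k : ℤ) (m : Fin n → ℤ) :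
    ∫⁻ x in cube k m, ‖dyadicExp f k x‖ₑ ≤ ∫⁻ x in cube k m, ‖f x‖ₑ := by
  rw [setLIntegral_congr_fun (g := fun _ => ‖⨍ y in cube k m, f y‖ₑ) (measurableSet_cube k m)
    fun x hx => by simp only [dyadicExp_of_mem hx], setLIntegral_const, setAverage_eq, enorm_smul,
    Real.enorm_eq_ofReal (by positivity), measureReal_def,
    ENNReal.ofReal_inv_of_pos (ENNReal.toReal_pos (volume_cube_ne_zero k m)
      (volume_cube_ne_top k m)), ENNReal.ofReal_toReal (volume_cube_ne_top k m), mul_comm, ← mul_assoc,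
    ENNReal.mul_inv_cancel (volume_cube_ne_zero k m) (volume_cube_ne_top k m), one_mul]
  exact enorm_integral_le_lintegral_enorm _

/-- Cauchy–Schwarz on a single cube, with the volume multiplied out. -/
theorem enorm_dyadicExp_le {f : Space n → ℂ} (hf : AEStronglyMeasurable f) (k : ℤ) (x : Space n) :
    ‖dyadicExp f k x‖ₑ ^ 2 * volume (cube k (cubeIndex k x)) ≤
      ∫⁻ y in cube k (cubeIndex k x), ‖f y‖ₑ ^ 2 := by
  set Q := cube k (cubeIndex k x)
  have hv0 : volume Q ≠ 0 := volume_cube_ne_zero k _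
  have hvt : volume Q ≠ ⊤ := volume_cube_ne_top k _
  have h1 : ‖dyadicExp f k x‖ₑ * volume Q ≤ ∫⁻ y in Q, ‖f y‖ₑ := by
    refine le_trans (le_of_eq ?_) (setLIntegral_enorm_dyadicExp_le f k (cubeIndex k x))
    rw [setLIntegral_congr_fun (g := fun _ => ‖dyadicExp f k x‖ₑ) (measurableSet_cube k _)
      fun y hy => by simp only [cubeConst_dyadicExp f k y x (cubeIndex_of_mem hy)],
      setLIntegral_const]
  have h2 : (∫⁻ y in Q, ‖f y‖ₑ) ^ 2 ≤ (∫⁻ y in Q, ‖f y‖ₑ ^ 2) * volume Q := by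
    have := ENNReal.lintegral_mul_le_Lp_mul_Lq (volume.restrict Q) Real.HolderConjugate.two_two
      (f := fun y => ‖f y‖ₑ) (g := fun _ => 1) hf.restrict.enorm aemeasurable_const
    simp only [Pi.mul_apply, mul_one, ENNReal.rpow_ofNat] at this
    calc _ ≤ _ := pow_le_pow_left' this 2
      _ = _ := by
        rw [mul_pow, ← ENNReal.rpow_natCast, ← ENNReal.rpow_natCast, ← ENNReal.rpow_mul,
          ← ENNReal.rpow_mul]
        norm_num
  have h3 : (‖dyadicExp f k x‖ₑ ^ 2 * volume Q) * volume Q ≤ (∫⁻ y in Q, ‖f y‖ₑ ^ 2) * volume Q := by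
    refine le_trans (le_of_eq ?_) (le_trans (pow_le_pow_left' h1 2) h2)
    ring
  exact (ENNReal.mul_le_mul_iff_left hv0 hvt).1 h3

theorem lintegral_enorm_dyadicExp_le (f : Space n → ℂ) (k : ℤ) :
    ∫⁻ x, ‖dyadicExp f k x‖ₑ ≤ ∫⁻ x, ‖f x‖ₑ := by
  rw [lintegral_eq_tsum_cube k, lintegral_eq_tsum_cube k fun x => ‖f x‖ₑ]
  exact ENNReal.tsum_le_tsum fun m => setLIntegral_enorm_dyadicExp_le f k m

theorem sqNorm_dyadicExp_le {f : Space n → ℂ} (hf : AEStronglyMeasurable f) (k : ℤ) :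
    sqNorm (dyadicExp f k) ≤ sqNorm f := by
  rw [sqNorm, sqNorm, lintegral_eq_tsum_cube k, lintegral_eq_tsum_cube k fun x => ‖f x‖ₑ ^ 2]
  refine ENNReal.tsum_le_tsum fun m => ?_
  rcases (cube k m).eq_empty_or_nonempty with he | ⟨z, hz⟩
  · simp [he]
  · have h := enorm_dyadicExp_le hf k z
    rw [cubeIndex_of_mem hz] at h
    rwa [setLIntegral_congr_fun (g := fun _ => ‖dyadicExp f k z‖ₑ ^ 2) (measurableSet_cube k m)
      fun y hy => by
        simp only [cubeConst_dyadicExp f k y z ((cubeIndex_of_mem hy).trans (cubeIndex_of_mem hz).symm)],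
      setLIntegral_const]

theorem memLp_two_iff {f : Space n → ℂ} :
    MemLp f 2 ↔ AEStronglyMeasurable f ∧ sqNorm f < ⊤ := by
  refine and_congr_right fun _ => ?_
  rw [eLpNorm_lt_top_iff_lintegral_rpow_enorm_lt_top (by norm_num) (by norm_num)]
  simp [sqNorm]

theorem sqNorm_eq_eLpNorm_sq (f : Space n → ℂ) : sqNorm f = eLpNorm f 2 ^ 2 := by
  rw [eLpNorm_eq_lintegral_rpow_enorm_toReal (by norm_num) (by norm_num), ← ENNReal.rpow_natCast,
    ← ENNReal.rpow_mul]
  simp [sqNorm]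

theorem memLp_dyadicExp {f : Space n → ℂ} (hf : MemLp f 2) (k : ℤ) : MemLp (dyadicExp f k) 2 :=
  memLp_two_iff.2 ⟨(cubeConst_dyadicExp f k).measurable.aestronglyMeasurable,
    (sqNorm_dyadicExp_le hf.1 k).trans_lt (memLp_two_iff.1 hf).2⟩

theorem memLp_dyadicDiff {f : Space n → ℂ} (hf : MemLp f 2) (k : ℤ) : MemLp (dyadicDiff f k) 2 :=
  (memLp_dyadicExp hf k).sub (memLp_dyadicExp hf (k - 1))

theorem integrable_dyadicExp {f : Space n → ℂ} (hf : Integrable f) (k : ℤ) :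
    Integrable (dyadicExp f k) :=
  ⟨(cubeConst_dyadicExp f k).measurable.aestronglyMeasurable,
    (lintegral_enorm_dyadicExp_le f k).trans_lt hf.2⟩

theorem cubeConst_dyadicDiff (f : Space n → ℂ) (k : ℤ) : CubeConst k (dyadicDiff f k) := by
  intro x y h
  simp only [dyadicDiff, cubeConst_dyadicExp f k x y h,
    (cubeConst_dyadicExp f (k - 1)).mono (by omega) x y h]

theorem meanZero_sub_dyadicExp {f : Space n → ℂ} (hf : MemLp f 2) (k : ℤ) :
    MeanZero k fun x => f x - dyadicExp f k x := by
  intro m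
  rw [integral_sub (integrableOn_cube hf k m) (integrableOn_cube (memLp_dyadicExp hf k) k m),
    setIntegral_dyadicExp, sub_self]

theorem setIntegral_dyadicExp_of_le {f : Space n → ℂ} (hf : MemLp f 2) {j k : ℤ} (hjk : j ≤ k)
    (m : Fin n → ℤ) : ∫ x in cube j m, dyadicExp f k x = ∫ x in cube j m, f x := by
  have h := (meanZero_sub_dyadicExp hf k).anti hjk m
  rw [integral_sub (integrableOn_cube hf j m) (integrableOn_cube (memLp_dyadicExp hf k) j m),
    sub_eq_zero] at h
  exact h.symm

theorem meanZero_dyadicDiff {f : Space n → ℂ} (hf : MemLp f 2) (k : ℤ) :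
    MeanZero (k - 1) (dyadicDiff f k) := by
  intro m
  simp only [dyadicDiff]
  rw [integral_sub (integrableOn_cube (memLp_dyadicExp hf k) _ m)
    (integrableOn_cube (memLp_dyadicExp hf (k - 1)) _ m), setIntegral_dyadicExp,
    setIntegral_dyadicExp_of_le hf (by omega), sub_self]

theorem sum_Ioc_sub {E : Type*} [AddCommGroup E] (e : ℤ → E) {j k : ℤ} (hjk : j ≤ k) :
    ∑ i ∈ Finset.Ioc j k, (e i - e (i - 1)) = e k - e j := by
  induction k, hjk using Int.leInduction with
  | base => simp
  | succ k hk ih =>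
    have : Finset.Ioc j (k + 1) = insert (k + 1) (Finset.Ioc j k) := by
      ext i
      simp only [Finset.mem_Ioc, Finset.mem_insert]
      omega
    rw [this, Finset.sum_insert (by simp), ih]
    simp

/-! ### Orthogonality of martingale differences and the Bessel inequality. -/

theorem sqNorm_eq_ofReal_integral {f : Space n → ℂ} (hf : MemLp f 2) :
    sqNorm f = ENNReal.ofReal (∫ x, ‖f x‖ ^ 2) := by
  rw [ofReal_integral_eq_lintegral_ofReal ((memLp_two_iff_integrable_sq_norm hf.1).1 hf)
    (ae_of_all _ fun x => by positivity), sqNorm]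
  refine lintegral_congr fun x => ?_
  rw [ENNReal.ofReal_pow (norm_nonneg _), ofReal_norm]

theorem sqNorm_add_of_integral_eq_zero {u v : Space n → ℂ} (hu : MemLp u 2) (hv : MemLp v 2)
    (h : ∫ x, starRingEnd ℂ (u x) * v x = 0) :
    sqNorm (fun x => u x + v x) = sqNorm u + sqNorm v := by
  have hint : Integrable fun x => starRingEnd ℂ (u x) * v x :=
    hu.star.integrable_mul hv
  have hu2 : Integrable fun x => ‖u x‖ ^ 2 := (memLp_two_iff_integrable_sq_norm hu.1).1 hu
  have hv2 : Integrable fun x => ‖v x‖ ^ 2 := (memLp_two_iff_integrable_sq_norm hv.1).1 hv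
  rw [sqNorm_eq_ofReal_integral hu, sqNorm_eq_ofReal_integral hv,
    show sqNorm (fun x => u x + v x) = _ from sqNorm_eq_ofReal_integral (hu.add hv),
    ← ENNReal.ofReal_add (by positivity) (by positivity),
    ← integral_add hu2 hv2]
  congr 1
  have hre : ∫ x, (starRingEnd ℂ (u x) * v x).re = 0 := by
    have := integral_re hint
    simp only [RCLike.re_to_complex] at this
    rw [this, h, Complex.zero_re]
  have hpt : ∀ x, ‖u x + v x‖ ^ 2 =
      (‖u x‖ ^ 2 + ‖v x‖ ^ 2) + 2 * (starRingEnd ℂ (u x) * v x).re := by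
    intro x
    rw [← Complex.normSq_eq_norm_sq, ← Complex.normSq_eq_norm_sq, ← Complex.normSq_eq_norm_sq,
      Complex.normSq_add]
    simp
  have hint' : Integrable fun x => 2 * (starRingEnd ℂ (u x) * v x).re := hint.re.const_mul 2
  simp only [hpt]
  rw [integral_add (f := fun x => ‖u x‖ ^ 2 + ‖v x‖ ^ 2) (hu2.add hv2) hint',
    integral_const_mul, hre, mul_zero, add_zero]

/-- Pythagoras: df_k has mean zero on the cubes of generation k-1, on which f_{k-1} is constant.
Telescoping this identity gives the Bessel inequality below. -/
theorem sqNorm_dyadicExp_succ {f : Space n → ℂ} (hf : MemLp f 2) (k : ℤ) :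
    sqNorm (dyadicExp f k) = sqNorm (dyadicExp f (k - 1)) + sqNorm (dyadicDiff f k) := by
  rw [← sqNorm_add_of_integral_eq_zero (memLp_dyadicExp hf (k - 1)) (memLp_dyadicDiff hf k)]
  · simp [dyadicDiff]
  · refine (meanZero_dyadicDiff hf k).integral_mul_eq_zero fun x y h => ?_
    rw [cubeConst_dyadicExp f _ x y h]

theorem sum_sqNorm_dyadicDiff_le {f : Space n → ℂ} (hf : MemLp f 2) {j k : ℤ} (hjk : j ≤ k) :
    ∑ i ∈ Finset.Ioc j k, sqNorm (dyadicDiff f i) ≤ sqNorm (dyadicExp f k) := by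
  induction k, hjk using Int.leInduction with
  | base => simp
  | succ k hk ih =>
    have : Finset.Ioc j (k + 1) = insert (k + 1) (Finset.Ioc j k) := by
      ext i
      simp only [Finset.mem_Ioc, Finset.mem_insert]
      omega
    rw [this, Finset.sum_insert (by simp), sqNorm_dyadicExp_succ hf (k + 1), add_comm]
    gcongr
    simpa using ih

theorem tsum_sqNorm_dyadicDiff_le {f : Space n → ℂ} (hf : MemLp f 2) :
    ∑' i : ℤ, sqNorm (dyadicDiff f i) ≤ sqNorm f := by
  refine ENNReal.summable.tsum_le_of_sum_le fun S => ?_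
  obtain ⟨M, hM⟩ : ∃ M : ℕ, ∀ i ∈ S, i.natAbs < M :=
    ⟨S.sup Int.natAbs + 1, fun i hi => Nat.lt_succ_of_le (Finset.le_sup (f := Int.natAbs) hi)⟩
  calc ∑ i ∈ S, sqNorm (dyadicDiff f i)
      ≤ ∑ i ∈ Finset.Ioc (-M : ℤ) M, sqNorm (dyadicDiff f i) := by
        refine Finset.sum_le_sum_of_subset fun i hi => ?_
        have := hM i hi
        simp only [Finset.mem_Ioc]; omega
    _ ≤ sqNorm (dyadicExp f M) := sum_sqNorm_dyadicDiff_le hf (by omega)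
    _ ≤ sqNorm f := sqNorm_dyadicExp_le hf.1 M

/-! ### Convergence of dyadic martingales -/

theorem add_sq_le_four_mul (a b : ℝ≥0∞) : (a + b) ^ 2 ≤ 4 * (a ^ 2 + b ^ 2) := by
  rcases le_total a b with h | h
  · calc (a + b) ^ 2 ≤ (b + b) ^ 2 := by gcongr
      _ = 4 * b ^ 2 := by ring
      _ ≤ _ := by gcongr; exact le_add_self
  · calc (a + b) ^ 2 ≤ (a + a) ^ 2 := by gcongr
      _ = 4 * a ^ 2 := by ring
      _ ≤ _ := by gcongr; exact le_self_add

theorem enorm_add_sq_le (a b : ℂ) : ‖a + b‖ₑ ^ 2 ≤ 4 * (‖a‖ₑ ^ 2 + ‖b‖ₑ ^ 2) :=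
  (pow_le_pow_left' (enorm_add_le a b) 2).trans (add_sq_le_four_mul _ _)

theorem sqNorm_add_le {u : Space n → ℂ} (hu : AEStronglyMeasurable u) (v : Space n → ℂ) :
    sqNorm (fun x => u x + v x) ≤ 4 * (sqNorm u + sqNorm v) := by
  rw [sqNorm, sqNorm, sqNorm, ← lintegral_add_left' (hu.enorm.pow_const 2),
    ← lintegral_const_mul' _ _ (by simp)]
  exact lintegral_mono fun x => enorm_add_sq_le _ _

theorem sqNorm_neg (u : Space n → ℂ) : sqNorm (fun x => -u x) = sqNorm u := by
  simp [sqNorm]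

theorem dyadicExp_sub {f g : Space n → ℂ} (hf : MemLp f 2) (hg : MemLp g 2) (k : ℤ) (x : Space n) :
    dyadicExp (fun y => f y - g y) k x = dyadicExp f k x - dyadicExp g k x := by
  simp only [dyadicExp, setAverage_eq]
  rw [integral_sub (integrableOn_cube hf k _) (integrableOn_cube hg k _), smul_sub]

theorem exists_continuous_sqNorm_sub_le {f : Space n → ℂ} (hf : MemLp f 2) {ε : ℝ≥0∞} (hε : ε ≠ 0) :
    ∃ φ : Space n → ℂ, HasCompactSupport φ ∧ Continuous φ ∧ sqNorm (fun x => f x - φ x) ≤ ε := by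
  obtain ⟨δ, hδ0, hδ⟩ : ∃ δ : ℝ≥0∞, δ ≠ 0 ∧ δ ^ 2 ≤ ε := by
    refine ⟨min ε 1, by simp [hε], ?_⟩
    calc (min ε 1) ^ 2 = min ε 1 * min ε 1 := sq _
      _ ≤ ε * 1 := by gcongr <;> simp
      _ = ε := mul_one _
  obtain ⟨φ, h1, h2, h3, -⟩ := hf.exists_hasCompactSupport_eLpNorm_sub_le (by norm_num) hδ0
  exact ⟨φ, h1, h3, (sqNorm_eq_eLpNorm_sq _).le.trans ((pow_le_pow_left' h2 2).trans hδ)⟩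

theorem tendsto_volume_cube (hn : 1 ≤ n) (k : ℤ) (m : ℕ → Fin n → ℤ) :
    Tendsto (fun M : ℕ => volume (cube (k - M) (m M))) atTop (𝓝 ⊤) := by
  simp only [volume_cube]
  have h1 : Tendsto (fun M : ℕ => ENNReal.ofReal ((2 : ℝ) ^ (-(k - M : ℤ)))) atTop (𝓝 ⊤) := by
    refine ENNReal.tendsto_ofReal_nhds_top.2 ?_
    have : (fun M : ℕ => (2 : ℝ) ^ (-(k - M : ℤ))) = fun M : ℕ => (2 : ℝ) ^ (-k) * 2 ^ M := by
      funext M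
      rw [neg_sub, sub_eq_neg_add, zpow_add₀ (by norm_num), zpow_natCast]
    rw [this]
    exact (tendsto_pow_atTop_atTop_of_one_lt (by norm_num)).const_mul_atTop (by positivity)
  refine tendsto_nhds_top_mono h1 ?_
  filter_upwards [h1.eventually (eventually_ge_nhds ENNReal.one_lt_top)] with M hM
  exact le_self_pow₀ hM (by omega)

/-- The average satisfies |f_Q|² |Q| ≤ ‖f‖², and |Q| tends to infinity because n ≥ 1. Pointwise
convergence is what the telescoping of g_k(x) - g_k(y) needs. -/
theorem tendsto_dyadicExp_bot (hn : 1 ≤ n) {f : Space n → ℂ} (hf : MemLp f 2) (k : ℤ) (x : Space n) :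
    Tendsto (fun M : ℕ => ‖dyadicExp f (k - M) x‖ₑ) atTop (𝓝 0) := by
  have h1 : Tendsto (fun M : ℕ => sqNorm f / volume (cube (k - M) (cubeIndex (k - M) x))) atTop
      (𝓝 0) := by
    have := ENNReal.Tendsto.const_div (tendsto_volume_cube hn k fun M => cubeIndex (k - M) x)
      (a := sqNorm f) (Or.inr (memLp_two_iff.1 hf).2.ne)
    simpa using this
  have h2 : Tendsto (fun M : ℕ => ‖dyadicExp f (k - M) x‖ₑ ^ 2) atTop (𝓝 0) := by
    refine tendsto_of_tendsto_of_tendsto_of_le_of_le tendsto_const_nhds h1 (fun _ => zero_le) ?_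
    intro M
    rw [ENNReal.le_div_iff_mul_le (Or.inl (volume_cube_ne_zero _ _))
      (Or.inl (volume_cube_ne_top _ _))]
    exact (enorm_dyadicExp_le hf.1 _ x).trans (setLIntegral_le_lintegral _ _)
  have h3 := ((ENNReal.continuous_rpow_const (y := 1 / 2)).tendsto 0).comp h2
  have h4 : ∀ a : ℝ≥0∞, (a ^ 2) ^ (1 / 2 : ℝ) = a := by
    intro a
    rw [← ENNReal.rpow_natCast, ← ENNReal.rpow_mul]
    norm_num
  simpa only [Function.comp_def, h4, ENNReal.zero_rpow_of_pos (by norm_num : (0 : ℝ) < 1 / 2)]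
    using h3

/-- For integrable φ, the bounds ‖φ_{-M}‖_∞ ≤ ‖φ‖_1/|Q| and ‖φ_{-M}‖_1 ≤ ‖φ‖_1 multiply to
‖φ_{-M}‖_2² ≤ ‖φ‖_1²/|Q|. The general case follows by density, since averaging contracts L_2. -/
theorem tendsto_sqNorm_dyadicExp_bot (hn : 1 ≤ n) {f : Space n → ℂ} (hf : MemLp f 2) :
    Tendsto (fun M : ℕ => sqNorm (dyadicExp f (-M))) atTop (𝓝 0) := by
  have key : ∀ φ : Space n → ℂ, Integrable φ →
      Tendsto (fun M : ℕ => sqNorm (dyadicExp φ (-M))) atTop (𝓝 0) := by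
    intro φ hφ
    set I := ∫⁻ x, ‖φ x‖ₑ
    have hI : I ≠ ⊤ := hφ.2.ne
    have h1 : Tendsto (fun M : ℕ => I * I / volume (cube (0 - M : ℤ) (0 : Fin n → ℤ))) atTop (𝓝 0) := by
      have := ENNReal.Tendsto.const_div (tendsto_volume_cube hn 0 fun M => 0)
        (a := I * I) (Or.inr (ENNReal.mul_ne_top hI hI))
      simpa using this
    refine tendsto_of_tendsto_of_tendsto_of_le_of_le tendsto_const_nhds h1 (fun _ => zero_le) ?_
    intro M
    simp only [zero_sub]
    have hb : ∀ x, ‖dyadicExp φ (-M) x‖ₑ ≤ I / volume (cube (-M) (0 : Fin n → ℤ)) := by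
      intro x
      rw [volume_cube, ← volume_cube (-M : ℤ) (cubeIndex (-M) x),
        ENNReal.le_div_iff_mul_le (Or.inl (volume_cube_ne_zero _ _)) (Or.inl (volume_cube_ne_top _ _))]
      have h2 := setLIntegral_enorm_dyadicExp_le φ (-M) (cubeIndex (-M) x)
      rw [setLIntegral_congr_fun (g := fun _ => ‖dyadicExp φ (-M) x‖ₑ) (measurableSet_cube _ _)
        fun y hy => by simp only [cubeConst_dyadicExp φ _ y x (cubeIndex_of_mem hy)],
        setLIntegral_const] at h2
      exact h2.trans (setLIntegral_le_lintegral _ _)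
    calc sqNorm (dyadicExp φ (-M))
        ≤ ∫⁻ x, I / volume (cube (-M) (0 : Fin n → ℤ)) * ‖dyadicExp φ (-M) x‖ₑ :=
          lintegral_mono fun x => by rw [sq]; gcongr; exact hb x
      _ = I / volume (cube (-M) (0 : Fin n → ℤ)) * ∫⁻ x, ‖dyadicExp φ (-M) x‖ₑ :=
          lintegral_const_mul _ (cubeConst_dyadicExp φ _).measurable.enorm
      _ ≤ I / volume (cube (-M) (0 : Fin n → ℤ)) * I := by
          gcongr; exact lintegral_enorm_dyadicExp_le φ _
      _ = _ := by rw [ENNReal.div_eq_inv_mul, ENNReal.div_eq_inv_mul]; ring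
  rw [ENNReal.tendsto_atTop_zero]
  intro ε hε
  have hε8 : ε / 8 ≠ 0 := by simp [hε.ne']
  obtain ⟨φ, hφc, hφ, hle⟩ := exists_continuous_sqNorm_sub_le hf hε8
  have hφ2 : MemLp φ 2 := hφ.memLp_of_hasCompactSupport hφc
  obtain ⟨N, hN⟩ := ENNReal.tendsto_atTop_zero.1 (key φ (hφ.integrable_of_hasCompactSupport hφc))
    (ε / 8) (pos_iff_ne_zero.2 hε8)
  refine ⟨N, fun M hM => ?_⟩
  have hsplit : dyadicExp f (-M) = fun x =>
      dyadicExp (fun y => f y - φ y) (-M) x + dyadicExp φ (-M) x := by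
    funext x
    rw [dyadicExp_sub hf hφ2, sub_add_cancel]
  rw [hsplit]
  refine (sqNorm_add_le (cubeConst_dyadicExp _ _).measurable.aestronglyMeasurable _).trans ?_
  calc _ ≤ 4 * (ε / 8 + ε / 8) := by
        gcongr
        · exact (sqNorm_dyadicExp_le (hf.sub hφ2).1 _).trans hle
        · exact hN M hM
    _ = ε := by
        rw [← two_mul, ← mul_assoc]
        norm_num
        exact ENNReal.mul_div_cancel (by norm_num) (by norm_num)

/-- Uniform continuity settles the case of continuous compactly supported functions; density and
contractivity give the rest. -/
theorem tendsto_sqNorm_sub_dyadicExp {f : Space n → ℂ} (hf : MemLp f 2) :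
    Tendsto (fun N : ℕ => sqNorm fun x => f x - dyadicExp f N x) atTop (𝓝 0) := by
  have key : ∀ φ : Space n → ℂ, Continuous φ → HasCompactSupport φ →
      Tendsto (fun N : ℕ => sqNorm fun x => φ x - dyadicExp φ N x) atTop (𝓝 0) := by
    intro φ hφ hc
    have hφ2 : MemLp φ 2 := hφ.memLp_of_hasCompactSupport hc
    obtain ⟨R, hR⟩ := hc.isBounded.subset_closedBall 0
    -- Cubes of generation M ≥ 0 have side at most 1, so averaging moves the support by at most 1.
    set V := volume (Metric.closedBall (0 : Space n) (R + 1))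
    have hV : V ≠ ⊤ := (isCompact_closedBall _ _).measure_ne_top
    rw [ENNReal.tendsto_atTop_zero]
    intro ε hε
    obtain ⟨δ, hδ0, hδ⟩ : ∃ δ : ℝ, 0 < δ ∧ ENNReal.ofReal δ ^ 2 * V ≤ ε := by
      have h0 : Tendsto (fun δ : ℝ => ENNReal.ofReal δ ^ 2 * V) (𝓝[>] 0) (𝓝 0) := by
        have h1 : Tendsto (fun δ : ℝ => ENNReal.ofReal δ ^ 2) (𝓝[>] 0) (𝓝 0) := by
          have : Continuous fun δ : ℝ => ENNReal.ofReal δ ^ 2 :=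
            (ENNReal.continuous_pow 2).comp ENNReal.continuous_ofReal
          have := (this.tendsto 0).mono_left (nhdsWithin_le_nhds (s := Ioi 0))
          simpa using this
        have := ENNReal.Tendsto.mul_const h1 (b := V) (Or.inr hV)
        simpa using this
      obtain ⟨δ, h1, h2⟩ := ((h0.eventually (eventually_le_nhds hε)).and
        self_mem_nhdsWithin).exists
      exact ⟨δ, h2, h1⟩
    obtain ⟨η, hη0, hη⟩ := Metric.uniformContinuous_iff.1
      (hc.uniformContinuous_of_continuous hφ) δ hδ0
    obtain ⟨N, hN⟩ := exists_pow_lt_of_lt_one hη0 (by norm_num : (2⁻¹ : ℝ) < 1)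
    refine ⟨N, fun M hM => ?_⟩
    have hpow : (2 : ℝ) ^ (-(M : ℤ)) = (2⁻¹ : ℝ) ^ M := by simp
    have hsmall : (2 : ℝ) ^ (-(M : ℤ)) < η := by
      rw [hpow]
      exact (pow_le_pow_of_le_one (by norm_num) (by norm_num) hM).trans_lt hN
    have hone : (2 : ℝ) ^ (-(M : ℤ)) ≤ 1 := by
      rw [hpow]; exact pow_le_one₀ (by norm_num) (by norm_num)
    have hbd : ∀ x, ‖φ x - dyadicExp φ M x‖ ≤ δ := by
      intro x
      have : dyadicExp φ M x ∈ Metric.closedBall (φ x) δ := by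
        refine (convex_closedBall _ _).set_average_mem Metric.isClosed_closedBall
          (volume_cube_ne_zero _ _) (volume_cube_ne_top _ _) ?_ (integrableOn_cube hφ2 _ _)
        refine (ae_restrict_iff' (measurableSet_cube _ _)).2 (ae_of_all _ fun y hy => ?_)
        refine (hη ?_).le
        rw [dist_eq_norm]
        exact (norm_sub_le_of_cubeIndex_eq (cubeIndex_of_mem hy)).trans_lt hsmall
      rwa [Metric.mem_closedBall, dist_eq_norm, norm_sub_rev] at this
    have hzero : ∀ x, x ∉ Metric.closedBall (0 : Space n) (R + 1) → φ x - dyadicExp φ M x = 0 := by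
      intro x hx
      have hz : ∀ y, cubeIndex M y = cubeIndex M x → φ y = 0 := by
        intro y hy
        by_contra hne
        have h1 := hR (subset_tsupport φ hne)
        have h2 := norm_sub_le_of_cubeIndex_eq hy.symm
        rw [mem_closedBall_zero_iff] at h1 hx
        have : ‖x‖ ≤ ‖x - y‖ + ‖y‖ := by simpa using norm_add_le (x - y) y
        linarith
      rw [hz x rfl, dyadicExp, setAverage_eq, setIntegral_congr_fun (g := fun _ => 0)
        (measurableSet_cube _ _) fun y hy => hz y (cubeIndex_of_mem hy)]
      simp
    calc sqNorm (fun x => φ x - dyadicExp φ M x)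
        ≤ ∫⁻ x, (Metric.closedBall (0 : Space n) (R + 1)).indicator
            (fun _ => ENNReal.ofReal δ ^ 2) x := by
          refine lintegral_mono fun x => ?_
          by_cases hx : x ∈ Metric.closedBall (0 : Space n) (R + 1)
          · rw [indicator_of_mem hx, ← ofReal_norm]
            gcongr
            exact hbd x
          · simp [hzero x hx]
      _ = ENNReal.ofReal δ ^ 2 * V := lintegral_indicator_const measurableSet_closedBall _
      _ ≤ ε := hδ
  rw [ENNReal.tendsto_atTop_zero]
  intro ε hε
  -- The constant 4 of `sqNorm_add_le` is paid twice: 4·(4·(1+1)+1) = 36.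
  have hε8 : ε / 36 ≠ 0 := by simp [hε.ne']
  obtain ⟨φ, hφc, hφ, hle⟩ := exists_continuous_sqNorm_sub_le hf hε8
  have hφ2 : MemLp φ 2 := hφ.memLp_of_hasCompactSupport hφc
  obtain ⟨N, hN⟩ := ENNReal.tendsto_atTop_zero.1 (key φ hφ hφc) (ε / 36) (pos_iff_ne_zero.2 hε8)
  refine ⟨N, fun M hM => ?_⟩
  have hsplit : (fun x => f x - dyadicExp f M x) = fun x => ((f x - φ x) +
      -dyadicExp (fun y => f y - φ y) M x) + (φ x - dyadicExp φ M x) := by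
    funext x
    rw [dyadicExp_sub hf hφ2]
    ring
  have hm : AEStronglyMeasurable fun x => f x - φ x := (hf.sub hφ2).1
  have hm2 : AEStronglyMeasurable (dyadicExp (fun y => f y - φ y) M) :=
    (cubeConst_dyadicExp _ _).measurable.aestronglyMeasurable
  rw [hsplit]
  refine (sqNorm_add_le (hm.add hm2.neg) _).trans ?_
  calc _ ≤ 4 * (4 * (ε / 36 + ε / 36) + ε / 36) := by
        gcongr
        · refine (sqNorm_add_le hm _).trans ?_
          rw [show sqNorm (-dyadicExp _ _) = _ from sqNorm_neg _]
          gcongr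
          exact (sqNorm_dyadicExp_le hm _).trans hle
        · exact hN M hM
    _ = 36 * (ε / 36) := by ring
    _ = ε := ENNReal.mul_div_cancel (by norm_num) (by norm_num)

/-! ### Weights -/

/-- The weight `2^{kn} (1 + 2^k |z|)^{-r}`, an approximate identity at scale `2^{-k}`. -/
def decay (r : ℝ) (k : ℤ) (z : Space n) : ℝ := ((2 : ℝ) ^ k) ^ n * (1 + (2 : ℝ) ^ k * ‖z‖) ^ (-r)

theorem decay_nonneg (r : ℝ) (k : ℤ) (z : Space n) : 0 ≤ decay r k z := by
  unfold decay; positivity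

theorem decay_neg (r : ℝ) (k : ℤ) (z : Space n) : decay r k (-z) = decay r k z := by
  simp [decay]

theorem measurable_decay (r : ℝ) (k : ℤ) : Measurable (decay r k : Space n → ℝ) := by
  unfold decay; fun_prop

/-- The integral of the weight of exponent `r`. -/
def decayMass (n : ℕ) (r : ℝ) : ℝ≥0∞ := ∫⁻ z : Space n, ENNReal.ofReal (decay r 0 z)

theorem decayMass_lt_top {r : ℝ} (hr : (n : ℝ) < r) : decayMass n r < ⊤ := by
  have := finite_integral_one_add_norm (E := Space n) (μ := volume) (r := r) (by simpa using hr)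
  simpa [decayMass, decay] using this

theorem lintegral_decay (r : ℝ) (k : ℤ) :
    ∫⁻ z : Space n, ENNReal.ofReal (decay r k z) = decayMass n r := by
  have h2 : (0 : ℝ) < (2 : ℝ) ^ k := by positivity
  have h := Measure.map_addHaar_smul (volume : Measure (Space n)) h2.ne'
  have h3 : ∫⁻ z : Space n, ENNReal.ofReal (decay r 0 ((2 : ℝ) ^ k • z)) =
      ENNReal.ofReal (((2 : ℝ) ^ k) ^ n)⁻¹ * decayMass n r := by
    rw [← lintegral_map (f := fun z : Space n => ENNReal.ofReal (decay r 0 z))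
      (measurable_decay r 0).ennreal_ofReal (measurable_const_smul ((2 : ℝ) ^ k)), h,
      lintegral_smul_measure, Module.finrank_fin_fun, abs_of_pos (by positivity)]
    rfl
  have h4 : ∀ z : Space n, ENNReal.ofReal (decay r k z) =
      ENNReal.ofReal (((2 : ℝ) ^ k) ^ n) * ENNReal.ofReal (decay r 0 ((2 : ℝ) ^ k • z)) := by
    intro z
    rw [← ENNReal.ofReal_mul (by positivity)]
    simp [decay, norm_smul]
  simp only [h4]
  rw [lintegral_const_mul' _ _ ENNReal.ofReal_ne_top, h3, ← mul_assoc,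
    ← ENNReal.ofReal_mul (by positivity), mul_inv_cancel₀ (by positivity), ENNReal.ofReal_one,
    one_mul]

theorem mul_le_weighted_sq {t : ℝ≥0∞} (h0 : t ≠ 0) (ht : t ≠ ⊤) (a b : ℝ≥0∞) :
    a * b ≤ t * a ^ 2 + t⁻¹ * b ^ 2 := by
  rcases le_total b (t * a) with h | h
  · calc a * b ≤ a * (t * a) := by gcongr
      _ = t * a ^ 2 := by ring
      _ ≤ _ := le_self_add
  · have ha : a ≤ t⁻¹ * b := by
      calc a = t⁻¹ * (t * a) := by rw [← mul_assoc, ENNReal.inv_mul_cancel h0 ht, one_mul]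
        _ ≤ _ := by gcongr
    calc a * b ≤ (t⁻¹ * b) * b := by gcongr
      _ = t⁻¹ * b ^ 2 := by ring
      _ ≤ _ := le_add_self

/-- The positive bilinear form `∬ P_k(x - y) u(y) v(x) dy dx`. -/
def weightForm (r : ℝ) (k : ℤ) (u v : Space n → ℝ≥0∞) : ℝ≥0∞ :=
  ∫⁻ x, ∫⁻ y, ENNReal.ofReal (decay r k (x - y)) * (u y * v x)

theorem measurable_decay_sub (r : ℝ) (k : ℤ) :
    Measurable fun p : Space n × Space n => ENNReal.ofReal (decay r k (p.1 - p.2)) :=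
  ((measurable_decay r k).comp (measurable_fst.sub measurable_snd)).ennreal_ofReal

theorem measurable_decay_const_sub (r : ℝ) (k : ℤ) (x : Space n) :
    Measurable fun y : Space n => ENNReal.ofReal (decay r k (x - y)) := by
  have h : Measurable fun y : Space n => x - y := by fun_prop
  exact ((measurable_decay r k).comp h).ennreal_ofReal

theorem measurable_decay_sub_const (r : ℝ) (k : ℤ) (y : Space n) :
    Measurable fun x : Space n => ENNReal.ofReal (decay r k (x - y)) := by
  have h : Measurable fun x : Space n => x - y := by fun_prop
  exact ((measurable_decay r k).comp h).ennreal_ofReal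

theorem weightForm_comm (r : ℝ) (k : ℤ) {u v : Space n → ℝ≥0∞} (hu : Measurable u)
    (hv : Measurable v) : weightForm r k u v = weightForm r k v u := by
  unfold weightForm
  rw [lintegral_lintegral_swap]
  · refine lintegral_congr fun x => lintegral_congr fun y => ?_
    rw [← decay_neg, neg_sub, mul_comm (u x)]
  · exact ((measurable_decay_sub r k).mul
      ((hu.comp measurable_snd).mul (hv.comp measurable_fst))).aemeasurable

theorem lintegral_decay_sub (r : ℝ) (k : ℤ) (x : Space n) :
    ∫⁻ y : Space n, ENNReal.ofReal (decay r k (x - y)) = decayMass n r := by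
  rw [lintegral_sub_left_eq_self (fun z : Space n => ENNReal.ofReal (decay r k z)), lintegral_decay]

/-- Weighted AM–GM under the integral. The factor `D` may depend on both variables, so that it can
be a difference |h(x) - h(y)| as well as a function of x alone. -/
theorem lintegral_lintegral_decay_mul_le {t : ℝ≥0∞} (h0 : t ≠ 0) (ht : t ≠ ⊤) (r : ℝ) (k : ℤ)
    {u : Space n → ℝ≥0∞} (hu : Measurable u) {D : Space n → Space n → ℝ≥0∞}
    (hD : Measurable fun p : Space n × Space n => D p.1 p.2) :
    ∫⁻ x, ∫⁻ y, ENNReal.ofReal (decay r k (x - y)) * (u y * D x y) ≤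
      t * (decayMass n r * ∫⁻ y, u y ^ 2) +
        t⁻¹ * ∫⁻ x, ∫⁻ y, ENNReal.ofReal (decay r k (x - y)) * D x y ^ 2 := by
  have hP := measurable_decay_sub (n := n) r k
  have hm1 : Measurable fun p : Space n × Space n =>
      ENNReal.ofReal (decay r k (p.1 - p.2)) * u p.2 ^ 2 :=
    hP.mul ((hu.comp measurable_snd).pow_const 2)
  have hm2 : Measurable fun p : Space n × Space n =>
      ENNReal.ofReal (decay r k (p.1 - p.2)) * D p.1 p.2 ^ 2 := hP.mul (hD.pow_const 2)
  have hswap : ∫⁻ x : Space n, ∫⁻ y : Space n, ENNReal.ofReal (decay r k (x - y)) * u y ^ 2 =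
      decayMass n r * ∫⁻ y, u y ^ 2 := by
    rw [lintegral_lintegral_swap hm1.aemeasurable, ← lintegral_const_mul _ (hu.pow_const 2)]
    refine lintegral_congr fun y => ?_
    rw [lintegral_mul_const _ (measurable_decay_sub_const r k y), ← lintegral_decay_sub r k y]
    congr 1
    refine lintegral_congr fun x => ?_
    rw [← decay_neg, neg_sub]
  calc ∫⁻ x, ∫⁻ y, ENNReal.ofReal (decay r k (x - y)) * (u y * D x y)
      ≤ ∫⁻ x, ∫⁻ y, (t * (ENNReal.ofReal (decay r k (x - y)) * u y ^ 2) +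
          t⁻¹ * (ENNReal.ofReal (decay r k (x - y)) * D x y ^ 2)) := by
        refine lintegral_mono fun x => lintegral_mono fun y => ?_
        calc _ ≤ ENNReal.ofReal (decay r k (x - y)) * (t * u y ^ 2 + t⁻¹ * D x y ^ 2) := by
              gcongr; exact mul_le_weighted_sq h0 ht _ _
          _ = _ := by ring
    _ = ∫⁻ x, (t * (∫⁻ y, ENNReal.ofReal (decay r k (x - y)) * u y ^ 2) +
          t⁻¹ * ∫⁻ y, ENNReal.ofReal (decay r k (x - y)) * D x y ^ 2) := by
        refine lintegral_congr fun x => ?_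
        have hx1 : Measurable fun y => ENNReal.ofReal (decay r k (x - y)) * u y ^ 2 :=
          (measurable_decay_const_sub r k x).mul (hu.pow_const 2)
        have hx2 : Measurable fun y => ENNReal.ofReal (decay r k (x - y)) * D x y ^ 2 :=
          (measurable_decay_const_sub r k x).mul ((hD.comp measurable_prodMk_left).pow_const 2)
        rw [lintegral_add_left (hx1.const_mul t), lintegral_const_mul _ hx1,
          lintegral_const_mul _ hx2]
    _ = _ := by
        rw [lintegral_add_left (hm1.lintegral_prod_right'.const_mul t),
          lintegral_const_mul _ hm1.lintegral_prod_right',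
          lintegral_const_mul _ hm2.lintegral_prod_right', hswap]

theorem weightForm_le {t : ℝ≥0∞} (h0 : t ≠ 0) (ht : t ≠ ⊤) (r : ℝ) (k : ℤ)
    {u v : Space n → ℝ≥0∞} (hu : Measurable u) (hv : Measurable v) :
    weightForm r k u v ≤ decayMass n r * (t * ∫⁻ y, u y ^ 2) +
      decayMass n r * (t⁻¹ * ∫⁻ x, v x ^ 2) := by
  refine (lintegral_lintegral_decay_mul_le h0 ht r k hu
    (D := fun x _ => v x) (hv.comp measurable_fst)).trans (le_of_eq ?_)
  have : ∀ x : Space n, ∫⁻ y : Space n, ENNReal.ofReal (decay r k (x - y)) * v x ^ 2 =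
      decayMass n r * v x ^ 2 := by
    intro x
    rw [lintegral_mul_const _ (measurable_decay_const_sub r k x), lintegral_decay_sub r k x]
  simp only [this]
  rw [lintegral_const_mul _ (hv.pow_const 2)]
  ring

/-! ### Kernels -/

theorem IsCZKernel.const_nonneg (hn : 1 ≤ n) {γ A : ℝ} {K : Space n → Space n → ℂ}
    (hK : IsCZKernel γ A K) : 0 ≤ A := by
  have hne : (fun _ => 1 : Space n) ≠ fun _ => 0 := fun h => by
    simpa using congrFun h ⟨0, hn⟩
  have h := (norm_nonneg _).trans (hK.size _ _ hne)
  have hpos : 0 < ‖(fun _ => 1 : Space n) - fun _ => 0‖ := norm_pos_iff.2 (sub_ne_zero.2 hne)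
  exact le_of_not_gt fun hA => absurd h (not_le.2 (div_neg_of_neg_of_pos hA (by positivity)))

theorem IsCZKernel.transpose {γ A : ℝ} {K : Space n → Space n → ℂ}
    (hK : IsCZKernel γ A K) : IsCZKernel γ A fun x y => K y x where
  size x y h := by simpa only [norm_sub_rev] using hK.size y x h.symm
  smooth_left x x' y h h' := by
    simpa only [norm_sub_rev y x] using hK.smooth_right y x x' h.symm (by rwa [norm_sub_rev y x])
  smooth_right x y y' h h' := by
    simpa only [norm_sub_rev y x] using hK.smooth_left y y' x h.symm (by rwa [norm_sub_rev y x])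

open Classical in
/-- The kernel `K` set to zero on the diagonal. -/
def offDiag (K : Space n → Space n → ℂ) (x y : Space n) : ℂ := if x = y then 0 else K x y

theorem offDiag_of_ne {K : Space n → Space n → ℂ} {x y : Space n} (h : x ≠ y) :
    offDiag K x y = K x y := if_neg h

theorem IsCZKernel.offDiag {γ A : ℝ} {K : Space n → Space n → ℂ}
    (hK : IsCZKernel γ A K) : IsCZKernel γ A (offDiag K) where
  size x y h := by rw [offDiag_of_ne h]; exact hK.size x y h
  smooth_left x x' y h h' := by
    have hne : x' ≠ y := by
      rintro rfl
      have := norm_pos_iff.2 (sub_ne_zero.2 h)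
      linarith
    rw [offDiag_of_ne h, offDiag_of_ne hne]; exact hK.smooth_left x x' y h h'
  smooth_right x y y' h h' := by
    have hne : x ≠ y' := by
      rintro rfl
      have := norm_pos_iff.2 (sub_ne_zero.2 h)
      rw [norm_sub_rev] at h'
      linarith
    rw [offDiag_of_ne h, offDiag_of_ne hne]; exact hK.smooth_right x y y' h h'

/-- The two smoothness conditions together give joint continuity off the diagonal, hence joint
measurability of `offDiag K`, which Fubini requires. -/
theorem IsCZKernel.continuousOn {γ A : ℝ} (hγ : 0 < γ) {K : Space n → Space n → ℂ}
    (hK : IsCZKernel γ A K) :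
    ContinuousOn (fun p : Space n × Space n => K p.1 p.2) {p | p.1 ≠ p.2} := by
  rintro ⟨x, y⟩ hxy
  have hxy : x ≠ y := hxy
  have hpos : 0 < ‖x - y‖ := norm_pos_iff.2 (sub_ne_zero.2 hxy)
  refine ContinuousAt.continuousWithinAt ?_
  rw [ContinuousAt, tendsto_iff_norm_sub_tendsto_zero]
  have hc1 : ContinuousAt (fun p : Space n × Space n => ‖x - p.2‖) (x, y) := by fun_prop
  have hc2 : ContinuousAt (fun p : Space n × Space n => ‖x - p.1‖) (x, y) := by fun_prop
  have hc3 : ContinuousAt (fun p : Space n × Space n => ‖y - p.2‖) (x, y) := by fun_prop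
  have h1 : Tendsto (fun p : Space n × Space n =>
      A * ‖x - p.1‖ ^ γ / ‖x - p.2‖ ^ ((n : ℝ) + γ) + A * ‖y - p.2‖ ^ γ / ‖x - y‖ ^ ((n : ℝ) + γ))
      (𝓝 (x, y)) (𝓝 0) := by
    have : ContinuousAt (fun p : Space n × Space n =>
        A * ‖x - p.1‖ ^ γ / ‖x - p.2‖ ^ ((n : ℝ) + γ) + A * ‖y - p.2‖ ^ γ / ‖x - y‖ ^ ((n : ℝ) + γ))
        (x, y) := by
      refine ContinuousAt.add (ContinuousAt.div ?_ ?_ ?_) (ContinuousAt.div_const ?_ _)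
      · exact continuousAt_const.mul (hc2.rpow_const (Or.inr hγ.le))
      · exact hc1.rpow_const (Or.inl hpos.ne')
      · exact (Real.rpow_pos_of_pos hpos _).ne'
      · exact continuousAt_const.mul (hc3.rpow_const (Or.inr hγ.le))
    have h := this.tendsto
    simpa [Real.zero_rpow hγ.ne'] using h
  have e1 : ∀ᶠ p : Space n × Space n in 𝓝 (x, y), 0 < ‖x - p.2‖ := hc1.eventually_const_lt hpos
  have e2 : ∀ᶠ p : Space n × Space n in 𝓝 (x, y), ‖x - p.1‖ < ‖x - p.2‖ / 2 :=
    hc2.eventually_lt (hc1.div_const 2) (by simpa [sub_eq_zero] using hxy)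
  have e3 : ∀ᶠ p : Space n × Space n in 𝓝 (x, y), ‖y - p.2‖ < ‖x - y‖ / 2 :=
    hc3.eventually_lt continuousAt_const (by simpa [sub_eq_zero] using hxy)
  refine squeeze_zero' (Eventually.of_forall fun _ => norm_nonneg _) ?_ h1
  filter_upwards [e1, e2, e3] with p h1 h2 h3
  have a1 := hK.smooth_left x p.1 p.2 (fun h => by simp [h] at h1) h2.le
  have a2 := hK.smooth_right x y p.2 hxy h3.le
  calc ‖K p.1 p.2 - K x y‖ = ‖(K x p.2 - K p.1 p.2) + (K x y - K x p.2)‖ := by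
        rw [← norm_neg]; congr 1; ring
    _ ≤ _ := (norm_add_le _ _).trans (add_le_add a1 a2)

theorem IsCZKernel.measurable_offDiag {γ A : ℝ} (hγ : 0 < γ) {K : Space n → Space n → ℂ}
    (hK : IsCZKernel γ A K) : Measurable fun p : Space n × Space n => PseudoLoc.offDiag K p.1 p.2 := by
  classical
  have hm : MeasurableSet {p : Space n × Space n | p.1 ≠ p.2} :=
    (isClosed_diagonal (X := Space n)).isOpen_compl.measurableSet
  have := ContinuousOn.measurable_piecewise (hK.continuousOn hγ) (g := fun _ => (0 : ℂ))
    continuousOn_const hm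
  convert this using 2 with p
  by_cases h : p.1 = p.2 <;> simp [PseudoLoc.offDiag, Set.piecewise, h]

/-- Moving y to its corner changes it by at most 2^{-k} ≤ ‖x - y‖/2, so smoothness in y applies.
Because ‖x - y‖ is comparable to 2^{-k}(1 + 2^k‖x - y‖), the denominator turns into the weight at
scale 2^{-k}. -/
theorem IsCZKernel.norm_sub_le_of_far {γ A : ℝ} (hγ0 : 0 < γ) (hγ1 : γ ≤ 1) (hA : 0 ≤ A)
    {K : Space n → Space n → ℂ} (hK : IsCZKernel γ A K) {k : ℤ} {m : ℕ} (hm : 1 ≤ m)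
    {x y : Space n} (h : Far k x y) :
    ‖K x y - K x (corner (k + m - 1) y)‖ ≤
      A * 2 ^ (n + 2) * (2 : ℝ) ^ (-γ * m) * decay ((n : ℝ) + γ) k (x - y) := by
  have hd := h.le_norm
  set d := ‖x - y‖ with hd'
  have hp : (0 : ℝ) < (2 : ℝ) ^ (-k) := by positivity
  have hd0 : 0 < d := by linarith
  have hc := norm_sub_corner_le (k + m - 1) y
  have hle : (2 : ℝ) ^ (-(k + m - 1 : ℤ)) ≤ (2 : ℝ) ^ (-k) :=
    zpow_le_zpow_right₀ (by norm_num) (by omega)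
  refine (hK.smooth_right x y _ (fun h => by simp [d, h] at hd0) (by linarith)).trans ?_
  have hkk : (2 : ℝ) ^ k * (2 : ℝ) ^ (-k) = 1 := by rw [← zpow_add₀ (by norm_num)]; simp
  have hk0 : (0 : ℝ) < (2 : ℝ) ^ k := by positivity
  set b := 1 + (2 : ℝ) ^ k * d with hb
  have hb0 : 0 < b := by positivity
  have hbd : b * (2 : ℝ) ^ (-k) / 2 ≤ d := by
    have : b * (2 : ℝ) ^ (-k) = (2 : ℝ) ^ (-k) + ((2 : ℝ) ^ k * (2 : ℝ) ^ (-k)) * d := by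
      rw [hb]; ring
    rw [this, hkk]; linarith
  have h1 : ‖y - corner (k + m - 1) y‖ ^ γ ≤ ((2 : ℝ) ^ (-(k + m - 1 : ℤ))) ^ γ :=
    Real.rpow_le_rpow (norm_nonneg _) hc hγ0.le
  have h2 : (b * (2 : ℝ) ^ (-k) / 2) ^ ((n : ℝ) + γ) ≤ d ^ ((n : ℝ) + γ) :=
    Real.rpow_le_rpow (by positivity) hbd (by positivity)
  calc A * ‖y - corner (k + m - 1) y‖ ^ γ / d ^ ((n : ℝ) + γ)
      ≤ A * ((2 : ℝ) ^ (-(k + m - 1 : ℤ))) ^ γ / (b * (2 : ℝ) ^ (-k) / 2) ^ ((n : ℝ) + γ) := by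
        gcongr
    -- A factor 2^{n+γ} comes from the 2 in `hbd`, and 2^γ from the generation k+m-1 in place of
    -- k+m.
    _ = A * (2 : ℝ) ^ (n + 2 * γ) * (2 : ℝ) ^ (-γ * m) * decay ((n : ℝ) + γ) k (x - y) := by
        rw [decay, ← hd', ← hb, Real.div_rpow (by positivity) (by norm_num),
          Real.mul_rpow hb0.le hp.le, ← Real.rpow_intCast 2 k, ← Real.rpow_intCast 2 (-k),
          ← Real.rpow_intCast 2 (-(k + m - 1)), ← Real.rpow_mul (by norm_num),
          ← Real.rpow_mul (by norm_num), ← Real.rpow_natCast, ← Real.rpow_mul (by norm_num),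
          Real.rpow_neg hb0.le, div_div_eq_mul_div, div_eq_mul_inv, mul_inv,
          ← Real.rpow_neg (by norm_num) ((_ : ℝ) * _)]
        have : (2 : ℝ) ^ (((-(k + m - 1) : ℤ) : ℝ) * γ) * (2 : ℝ) ^ ((n : ℝ) + γ) *
            (2 : ℝ) ^ (-(((-k : ℤ) : ℝ) * ((n : ℝ) + γ))) =
            (2 : ℝ) ^ (n + 2 * γ) * (2 : ℝ) ^ (-γ * m) * (2 : ℝ) ^ ((k : ℝ) * n) := by
          simp only [← Real.rpow_add (by norm_num : (0 : ℝ) < 2)]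
          congr 1
          push_cast
          ring
        linear_combination A * (b ^ ((n : ℝ) + γ))⁻¹ * this
    _ ≤ _ := by
        have : (2 : ℝ) ^ (n + 2 * γ) ≤ 2 ^ (n + 2) := by
          rw [← Real.rpow_natCast]
          refine Real.rpow_le_rpow_of_exponent_le (by norm_num) ?_
          push_cast
          linarith
        have := decay_nonneg ((n : ℝ) + γ) k (x - y)
        gcongr

/-- A crude bound, serving only integrability. -/
theorem IsCZKernel.norm_le_of_far {γ A : ℝ} (hA : 0 ≤ A) {K : Space n → Space n → ℂ}
    (hK : IsCZKernel γ A K) {k : ℤ} {x y : Space n} (h : Far k x y) :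
    ‖K x y‖ ≤ A / (4 * (2 : ℝ) ^ (-k)) ^ n := by
  have hd := h.le_norm
  have hp : (0 : ℝ) < (2 : ℝ) ^ (-k) := by positivity
  refine (hK.size x y fun h => ?_).trans ?_
  · rw [h, sub_self, norm_zero] at hd
    linarith
  gcongr

/-! ### The bilinear form of a kernel -/

/-- The bilinear form `∬ K(x,y) F(y) G(x) dy dx`. -/
def pairing (K : Space n → Space n → ℂ) (F G : Space n → ℂ) : ℂ :=
  ∫ p : Space n × Space n, K p.1 p.2 * (F p.2 * G p.1)

/-- The supports of `F` and `G` are far apart with respect to the dyadic cubes of generation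
`k`. -/
def Separated (k : ℤ) (F G : Space n → ℂ) : Prop := ∀ x y, F y ≠ 0 → G x ≠ 0 → Far k x y

theorem Separated.symm {k : ℤ} {F G : Space n → ℂ} (h : Separated k F G) : Separated k G F :=
  fun x y hG hF => (h y x hF hG).symm

theorem integrable_pairing {K : Space n → Space n → ℂ}
    (hKm : Measurable fun p : Space n × Space n => K p.1 p.2) {F G : Space n → ℂ}
    (hF : Integrable F) (hG : Integrable G) {C : ℝ}
    (hC : ∀ x y, F y ≠ 0 → G x ≠ 0 → ‖K x y‖ ≤ C) :
    Integrable fun p : Space n × Space n => K p.1 p.2 * (F p.2 * G p.1) := by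
  have hi : Integrable fun p : Space n × Space n => F p.2 * G p.1 := by
    rw [Measure.volume_eq_prod]
    simpa only [mul_comm] using hG.mul_prod hF
  refine (hi.norm.const_mul C).mono' (hKm.aestronglyMeasurable.mul hi.1) (ae_of_all _ fun p => ?_)
  rw [norm_mul]
  by_cases h : F p.2 = 0 ∨ G p.1 = 0
  · rcases h with h | h <;> simp [h]
  · push Not at h
    gcongr
    exact hC _ _ h.1 h.2

theorem integrable_pairing_of_separated {γ A : ℝ} (hA : 0 ≤ A) {K : Space n → Space n → ℂ}
    (hK : IsCZKernel γ A K) (hKm : Measurable fun p : Space n × Space n => K p.1 p.2) {k : ℤ}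
    {F G : Space n → ℂ} (hF : Integrable F) (hG : Integrable G) (hs : Separated k F G) :
    Integrable fun p : Space n × Space n => K p.1 p.2 * (F p.2 * G p.1) :=
  integrable_pairing hKm hF hG fun _ _ hF hG => hK.norm_le_of_far hA (hs _ _ hF hG)

theorem pairing_transpose (K : Space n → Space n → ℂ) (F G : Space n → ℂ) :
    pairing (fun x y => K y x) G F = pairing K F G := by
  unfold pairing
  rw [Measure.volume_eq_prod, ← integral_prod_swap]
  simp [mul_comm]

/-- The function y ↦ K(x, corner of y) is constant on cubes of generation k+m-1, so it integrates to
zero against F and can be subtracted from K(x, y) at no cost. -/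
theorem enorm_pairing_le_of_meanZero {γ A : ℝ} (hγ0 : 0 < γ) (hγ1 : γ ≤ 1) (hA : 0 ≤ A)
    {K : Space n → Space n → ℂ} (hK : IsCZKernel γ A K)
    (hKm : Measurable fun p : Space n × Space n => K p.1 p.2) {k : ℤ} {m : ℕ} (hm : 1 ≤ m)
    {F G : Space n → ℂ} (hF : Integrable F) (hG : Integrable G) (hs : Separated k F G)
    (hF0 : MeanZero (k + m - 1) F) :
    ‖pairing K F G‖ₑ ≤ ENNReal.ofReal (A * 2 ^ (n + 2) * (2 : ℝ) ^ (-γ * m)) *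
      weightForm ((n : ℝ) + γ) k (fun y => ‖F y‖ₑ) (fun x => ‖G x‖ₑ) := by
  unfold pairing
  rw [Measure.volume_eq_prod, integral_prod _ (by
    rw [← Measure.volume_eq_prod]; exact integrable_pairing_of_separated hA hK hKm hF hG hs)]
  refine (enorm_integral_le_lintegral_enorm _).trans ?_
  rw [weightForm, ← lintegral_const_mul' _ _ ENNReal.ofReal_ne_top]
  refine lintegral_mono fun x => ?_
  simp only
  rw [← lintegral_const_mul' _ _ ENNReal.ofReal_ne_top]
  by_cases hx : G x = 0
  · simp [hx]
  have hFx : ∀ y, F y ≠ 0 → Far k x y := fun y hy => hs x y hy hx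
  have hKx : Measurable fun y => K x y := hKm.comp measurable_prodMk_left
  have i1 : Integrable fun y => K x y * (F y * G x) := by
    refine ((hF.mul_const (G x)).norm.const_mul (A / (4 * (2 : ℝ) ^ (-k)) ^ n)).mono'
      (hKx.aestronglyMeasurable.mul (hF.mul_const (G x)).1) (ae_of_all _ fun y => ?_)
    rw [norm_mul]
    by_cases hy : F y = 0
    · simp [hy]
    · gcongr
      exact hK.norm_le_of_far hA (hFx y hy)
  have i2 : Integrable fun y => K x (corner (k + m - 1) y) * (F y * G x) := by
    refine ((hF.mul_const (G x)).norm.const_mul (A / (4 * (2 : ℝ) ^ (-k)) ^ n)).mono'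
      ((hKx.comp (measurable_corner _)).aestronglyMeasurable.mul (hF.mul_const (G x)).1)
      (ae_of_all _ fun y => ?_)
    rw [norm_mul]
    by_cases hy : F y = 0
    · simp [hy]
    · gcongr
      -- Since m ≥ 1, the corner lies in the same cube of generation k as y and is still far from x.
      refine hK.norm_le_of_far hA ((hFx y hy).symm.congr_left ?_).symm
      exact cubeIndex_eq_of_le (by omega) (cubeIndex_corner (k + m - 1) y).symm
  have hz : ∫ y, K x (corner (k + m - 1) y) * (F y * G x) = 0 := by
    have : MeanZero (k + m - 1) fun y => F y * G x := by
      intro j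
      rw [integral_mul_const, hF0 j, zero_mul]
    exact this.integral_mul_eq_zero (CubeConst.comp_corner _ _)
  rw [← sub_zero (∫ y, _), ← hz, ← integral_sub i1 i2]
  refine (enorm_integral_le_lintegral_enorm _).trans (lintegral_mono fun y => ?_)
  simp only
  by_cases hy : F y = 0
  · simp [hy]
  rw [← sub_mul, enorm_mul, enorm_mul (F y), ← mul_assoc (ENNReal.ofReal _),
    ← ENNReal.ofReal_mul (by positivity), ← ofReal_norm (K x y - _)]
  gcongr
  exact hK.norm_sub_le_of_far hγ0 hγ1 hA hm (hFx y hy)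

/-- The function with the finer cancellation is used, after transposing the kernel if it is G. This
gains 2^{-γ max(s,m)}, and max(s,m) ≥ (s+m)/2. -/
theorem enorm_pairing_le_of_meanZero_of_meanZero {γ A : ℝ} (hγ0 : 0 < γ) (hγ1 : γ ≤ 1) (hA : 0 ≤ A)
    {K : Space n → Space n → ℂ} (hK : IsCZKernel γ A K)
    (hKm : Measurable fun p : Space n × Space n => K p.1 p.2) {k : ℤ} {s m : ℕ} (hs1 : 1 ≤ s)
    (hm : 1 ≤ m) {F G : Space n → ℂ} (hFm : Measurable F) (hGm : Measurable G)
    (hF : Integrable F) (hG : Integrable G) (hs : Separated k F G)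
    (hF0 : MeanZero (k + s - 1) F) (hG0 : MeanZero (k + m - 1) G) :
    ‖pairing K F G‖ₑ ≤
      ENNReal.ofReal (A * 2 ^ (n + 2) * (2 : ℝ) ^ (-γ * s / 2)) *
        ENNReal.ofReal ((2 : ℝ) ^ (-γ * m / 2)) *
      weightForm ((n : ℝ) + γ) k (fun y => ‖F y‖ₑ) (fun x => ‖G x‖ₑ) := by
  rw [← ENNReal.ofReal_mul (by positivity), mul_assoc (A * _), ← Real.rpow_add (by norm_num)]
  rcases le_total m s with hms | hms
  · refine (enorm_pairing_le_of_meanZero hγ0 hγ1 hA hK hKm hs1 hF hG hs hF0).trans ?_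
    gcongr
    · norm_num
    · have : (m : ℝ) ≤ s := by exact_mod_cast hms
      nlinarith
  · rw [← pairing_transpose, weightForm_comm _ _ hFm.enorm hGm.enorm]
    refine (enorm_pairing_le_of_meanZero hγ0 hγ1 hA hK.transpose (hKm.comp measurable_swap) hm
      hG hF hs.symm hG0).trans ?_
    gcongr
    · norm_num
    · have : (s : ℝ) ≤ m := by exact_mod_cast hms
      nlinarith

/-! ### Translations of functions constant on dyadic cubes -/

/-- A point leaves the cube through some coordinate, hence lies in one of n slabs of thickness at
most min(|z|, ℓ), where ℓ = 2^{-j}. For 0 ≤ α ≤ 1 this minimum is at most ℓ(|z|/ℓ)^α. -/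
theorem volume_cube_diff_translate_le (j : ℤ) (m : Fin n → ℤ) (z : Space n) {α : ℝ} (hα0 : 0 ≤ α)
    (hα1 : α ≤ 1) :
    volume {x | x ∈ cube j m ∧ x + z ∉ cube j m} ≤
      n * ENNReal.ofReal ((‖z‖ * (2 : ℝ) ^ j) ^ α) * volume (cube j m) := by
  set a : Fin n → ℝ := fun i => (m i : ℝ) * (2 : ℝ) ^ (-j)
  set b : Fin n → ℝ := fun i => ((m i : ℝ) + 1) * (2 : ℝ) ^ (-j)
  have hp : (0 : ℝ) < (2 : ℝ) ^ (-j) := by positivity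
  have hjj : (2 : ℝ) ^ j * (2 : ℝ) ^ (-j) = 1 := by rw [← zpow_add₀ (by norm_num)]; simp
  have hab : ∀ i, b i - a i = (2 : ℝ) ^ (-j) := fun i => by simp only [a, b]; ring
  let S : Fin n → Set ℝ := fun i => {t | t ∈ Ico (a i) (b i) ∧ t + z i ∉ Ico (a i) (b i)}
  have hS : ∀ i, volume (S i) ≤
      ENNReal.ofReal ((‖z‖ * (2 : ℝ) ^ j) ^ α) * ENNReal.ofReal ((2 : ℝ) ^ (-j)) := by
    intro i
    rw [← ENNReal.ofReal_mul (by positivity)]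
    have hzi : |z i| ≤ ‖z‖ := norm_le_pi_norm z i
    have h1 : volume (S i) ≤ ENNReal.ofReal ((2 : ℝ) ^ (-j)) := by
      rw [← hab i, ← Real.volume_Ico]
      exact measure_mono fun t ht => ht.1
    have h2 : volume (S i) ≤ ENNReal.ofReal ‖z‖ := by
      rcases le_total 0 (z i) with h0 | h0
      · have : S i ⊆ Ico (b i - z i) (b i) := by
          rintro t ⟨ht, ht'⟩
          refine ⟨?_, ht.2⟩
          by_contra hlt
          exact ht' ⟨by linarith [ht.1], by linarith⟩
        refine (measure_mono this).trans ?_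
        rw [Real.volume_Ico]
        apply ENNReal.ofReal_le_ofReal
        rw [abs_of_nonneg h0] at hzi
        linarith
      · have : S i ⊆ Ico (a i) (a i - z i) := by
          rintro t ⟨ht, ht'⟩
          refine ⟨ht.1, ?_⟩
          by_contra hlt
          exact ht' ⟨by linarith, by linarith [ht.2]⟩
        refine (measure_mono this).trans ?_
        rw [Real.volume_Ico]
        apply ENNReal.ofReal_le_ofReal
        rw [abs_of_nonpos h0] at hzi
        linarith
    rcases le_total 1 (‖z‖ * (2 : ℝ) ^ j) with h | h
    · refine h1.trans (ENNReal.ofReal_le_ofReal ?_)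
      exact le_mul_of_one_le_left hp.le (Real.one_le_rpow h hα0)
    · refine h2.trans (ENNReal.ofReal_le_ofReal ?_)
      calc ‖z‖ = (‖z‖ * (2 : ℝ) ^ j) ^ (1 : ℝ) * (2 : ℝ) ^ (-j) := by
            rw [Real.rpow_one, mul_assoc, hjj, mul_one]
        _ ≤ _ := by
            gcongr ?_ * _
            rcases (norm_nonneg z).eq_or_lt' with h0 | h0
            · rw [h0]; simp only [zero_mul, Real.rpow_one]; positivity
            · exact Real.rpow_le_rpow_of_exponent_ge (by positivity) h hα1
  have hsub : {x | x ∈ cube j m ∧ x + z ∉ cube j m} ⊆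
      ⋃ i, Set.pi univ (Function.update (fun i => Ico (a i) (b i)) i (S i)) := by
    rintro x ⟨hx, hx'⟩
    simp only [cube, mem_ofPred_eq, not_forall] at hx'
    obtain ⟨i, hi⟩ := hx'
    refine mem_iUnion.2 ⟨i, fun l _ => ?_⟩
    rcases eq_or_ne l i with rfl | hl
    · rw [Function.update_self]; exact ⟨hx l, hi⟩
    · rw [Function.update_of_ne hl]; exact hx l
  refine (measure_mono hsub).trans ((measure_iUnion_le _).trans ?_)
  rw [tsum_fintype]
  have hterm : ∀ i : Fin n, volume (Set.pi univ (Function.update (fun i => Ico (a i) (b i)) i (S i))) ≤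
      ENNReal.ofReal ((‖z‖ * (2 : ℝ) ^ j) ^ α) * volume (cube j m) := by
    intro i
    have hq : ∀ l, volume (Function.update (fun i => Ico (a i) (b i)) i (S i) l) =
        Function.update (fun _ => ENNReal.ofReal ((2 : ℝ) ^ (-j))) i (volume (S i)) l := by
      intro l
      rcases eq_or_ne l i with rfl | hl
      · simp
      · rw [Function.update_of_ne hl, Function.update_of_ne hl, Real.volume_Ico, hab]
    rw [volume_pi_pi, Finset.prod_congr rfl fun l _ => hq l,
      Finset.prod_update_of_mem (Finset.mem_univ i), volume_cube, Finset.prod_const,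
      ← Finset.erase_eq, Finset.card_erase_of_mem (Finset.mem_univ i), Finset.card_univ, Fintype.card_fin]
    have hn : 1 ≤ n := by have := i.2; omega
    calc _ ≤ (ENNReal.ofReal ((‖z‖ * (2 : ℝ) ^ j) ^ α) * ENNReal.ofReal ((2 : ℝ) ^ (-j))) *
          ENNReal.ofReal ((2 : ℝ) ^ (-j)) ^ (n - 1) := by gcongr; exact hS i
      _ = _ := by
          rw [mul_assoc, ← pow_succ', Nat.sub_add_cancel hn]
  refine (Finset.sum_le_sum fun i _ => hterm i).trans ?_
  simp [mul_assoc]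

theorem lintegral_indicator_translate_le {j : ℤ} {h : Space n → ℂ} (hh : CubeConst j h) (z : Space n)
    {α : ℝ} (hα0 : 0 ≤ α) (hα1 : α ≤ 1) :
    ∫⁻ x, {x | cubeIndex j (x + z) ≠ cubeIndex j x}.indicator (fun x => ‖h x‖ₑ ^ 2) x ≤
      n * ENNReal.ofReal ((‖z‖ * (2 : ℝ) ^ j) ^ α) * sqNorm h := by
  have hmz : Measurable fun x : Space n => cubeIndex j (x + z) :=
    (measurable_cubeIndex j).comp (measurable_id.add_const z)
  have hS : MeasurableSet {x : Space n | cubeIndex j (x + z) ≠ cubeIndex j x} :=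
    (measurableSet_eq_fun hmz (measurable_cubeIndex j)).compl
  rw [sqNorm, lintegral_eq_tsum_cube j, lintegral_eq_tsum_cube j fun x => ‖h x‖ₑ ^ 2,
    ← ENNReal.tsum_mul_left]
  refine ENNReal.tsum_le_tsum fun m => ?_
  rcases (cube j m).eq_empty_or_nonempty with he | ⟨w, hw⟩
  · simp [he]
  have hc : ∀ x ∈ cube j m, h x = h w := fun x hx =>
    hh x w ((cubeIndex_of_mem hx).trans (cubeIndex_of_mem hw).symm)
  have hset : {x : Space n | cubeIndex j (x + z) ≠ cubeIndex j x} ∩ cube j m =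
      {x | x ∈ cube j m ∧ x + z ∉ cube j m} := by
    ext x
    simp only [mem_inter_iff, mem_ofPred_eq, and_comm (b := x ∈ cube j m)]
    refine and_congr_right fun hx => ?_
    rw [mem_cube_iff, cubeIndex_of_mem hx, ne_comm]
  have e1 := setLIntegral_congr_fun (μ := volume) (measurableSet_cube j m)
    (f := fun x => {x : Space n | cubeIndex j (x + z) ≠ cubeIndex j x}.indicator
      (fun x => ‖h x‖ₑ ^ 2) x)
    (g := fun x => {x : Space n | cubeIndex j (x + z) ≠ cubeIndex j x}.indicator
      (fun _ => ‖h w‖ₑ ^ 2) x) fun x hx => by simp only [indicator, hc x hx]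
  have e2 := setLIntegral_congr_fun (μ := volume) (measurableSet_cube j m)
    (f := fun x => ‖h x‖ₑ ^ 2) (g := fun x => ‖h w‖ₑ ^ 2) fun x hx => by simp only [hc x hx]
  rw [e1, e2, lintegral_indicator_const hS, setLIntegral_const, Measure.restrict_apply hS, hset]
  calc _ ≤ ‖h w‖ₑ ^ 2 * (n * ENNReal.ofReal ((‖z‖ * (2 : ℝ) ^ j) ^ α) * volume (cube j m)) := by
        gcongr; exact volume_cube_diff_translate_le j m z hα0 hα1
    _ = _ := by ring

/-- The difference h(x+z) - h(x) vanishes unless x and x+z lie in different cubes. Translating back,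
the term |h(x+z)|² becomes the same estimate for -z; hence 8 = 4·2. -/
theorem sqNorm_translate_sub_le {j : ℤ} {h : Space n → ℂ} (hh : CubeConst j h) (z : Space n)
    {α : ℝ} (hα0 : 0 ≤ α) (hα1 : α ≤ 1) :
    sqNorm (fun x => h (x + z) - h x) ≤
      8 * n * ENNReal.ofReal ((‖z‖ * (2 : ℝ) ^ j) ^ α) * sqNorm h := by
  set u : Space n → Space n → ℝ≥0∞ := fun z x =>
    {x | cubeIndex j (x + z) ≠ cubeIndex j x}.indicator (fun x => ‖h x‖ₑ ^ 2) x
  have hum : Measurable (u z) := by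
    have hmz : Measurable fun x : Space n => cubeIndex j (x + z) :=
      (measurable_cubeIndex j).comp (measurable_id.add_const z)
    exact (hh.measurable.enorm.pow_const 2).indicator
      (measurableSet_eq_fun hmz (measurable_cubeIndex j)).compl
  have hpt : ∀ x, ‖h (x + z) - h x‖ₑ ^ 2 ≤ 4 * (u z x + u (-z) (x + z)) := by
    intro x
    by_cases hx : cubeIndex j (x + z) = cubeIndex j x
    · simp [hh _ _ hx]
    · have h1 : u z x = ‖h x‖ₑ ^ 2 := indicator_of_mem (by exact hx) _
      have h2 : u (-z) (x + z) = ‖h (x + z)‖ₑ ^ 2 :=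
        indicator_of_mem (by
          show cubeIndex j (x + z + -z) ≠ cubeIndex j (x + z)
          rw [add_neg_cancel_right]
          exact Ne.symm hx) _
      rw [h1, h2, sub_eq_add_neg, add_comm (‖h x‖ₑ ^ 2)]
      simpa using enorm_add_sq_le (h (x + z)) (-h x)
  calc sqNorm (fun x => h (x + z) - h x) ≤ ∫⁻ x, 4 * (u z x + u (-z) (x + z)) := lintegral_mono hpt
    _ = 4 * ((∫⁻ x, u z x) + ∫⁻ x, u (-z) x) := by
        rw [lintegral_const_mul' _ _ (by norm_num), lintegral_add_left hum,
          lintegral_add_right_eq_self (fun x => u (-z) x) z]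
    _ ≤ 4 * (n * ENNReal.ofReal ((‖z‖ * (2 : ℝ) ^ j) ^ α) * sqNorm h +
          n * ENNReal.ofReal ((‖z‖ * (2 : ℝ) ^ j) ^ α) * sqNorm h) := by
        gcongr
        · exact lintegral_indicator_translate_le hh z hα0 hα1
        · simpa using lintegral_indicator_translate_le hh (-z) hα0 hα1
    _ = _ := by ring

/-- The translation estimate is taken with α = γ/2. The resulting growth (2^k|z|)^{γ/2} is absorbed
by half of the surplus decay of the weight, and exponent n + γ/2 is still integrable. -/
theorem lintegral_decay_sq_sub_le {γ : ℝ} (hγ0 : 0 < γ) (hγ1 : γ ≤ 1) (k : ℤ) (i : ℕ)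
    {h : Space n → ℂ} (hh : CubeConst (k - i) h) :
    ∫⁻ x, ∫⁻ y, ENNReal.ofReal (decay ((n : ℝ) + γ) k (x - y)) * ‖h x - h y‖ₑ ^ 2 ≤
      8 * n * decayMass n ((n : ℝ) + γ / 2) * ENNReal.ofReal ((2 : ℝ) ^ (-γ * i / 2)) * sqNorm h := by
  have hhm := hh.measurable
  have hD := measurable_decay_sub (n := n) ((n : ℝ) + γ) k
  have hm : Measurable fun p : Space n × Space n =>
      ENNReal.ofReal (decay ((n : ℝ) + γ) k (p.1 - p.2)) * ‖h p.1 - h p.2‖ₑ ^ 2 :=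
    hD.mul (((hhm.comp measurable_fst).sub (hhm.comp measurable_snd)).enorm.pow_const 2)
  have hm' : Measurable fun p : Space n × Space n =>
      ENNReal.ofReal (decay ((n : ℝ) + γ) k p.2) * ‖h (p.1 + p.2) - h p.1‖ₑ ^ 2 := by
    have h1 : Measurable fun p : Space n × Space n => h (p.1 + p.2) :=
      hhm.comp (measurable_fst.add measurable_snd)
    exact ((measurable_decay _ k).comp measurable_snd).ennreal_ofReal.mul
      ((h1.sub (hhm.comp measurable_fst)).enorm.pow_const 2)
  rw [lintegral_lintegral_swap hm.aemeasurable]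
  have hshift : ∀ y : Space n,
      ∫⁻ x, ENNReal.ofReal (decay ((n : ℝ) + γ) k (x - y)) * ‖h x - h y‖ₑ ^ 2 =
        ∫⁻ z, ENNReal.ofReal (decay ((n : ℝ) + γ) k z) * ‖h (y + z) - h y‖ₑ ^ 2 := by
    intro y
    rw [← lintegral_add_left_eq_self _ y]
    simp
  simp only [hshift]
  rw [lintegral_lintegral_swap hm'.aemeasurable, ← lintegral_decay _ k]
  have hz : ∀ z : Space n,
      ∫⁻ y, ENNReal.ofReal (decay ((n : ℝ) + γ) k z) * ‖h (y + z) - h y‖ₑ ^ 2 ≤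
        ENNReal.ofReal (decay ((n : ℝ) + γ / 2) k z) *
          (8 * n * ENNReal.ofReal ((2 : ℝ) ^ (-γ * i / 2)) * sqNorm h) := by
    intro z
    rw [lintegral_const_mul' _ _ ENNReal.ofReal_ne_top]
    have h1 := sqNorm_translate_sub_le hh z (α := γ / 2) (by linarith) (by linarith)
    refine (mul_le_mul_right h1 _).trans ?_
    have h2 : decay ((n : ℝ) + γ) k z * (‖z‖ * (2 : ℝ) ^ (k - i)) ^ (γ / 2) ≤
        decay ((n : ℝ) + γ / 2) k z * (2 : ℝ) ^ (-γ * i / 2) := by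
      have e1 : (‖z‖ * (2 : ℝ) ^ (k - i)) ^ (γ / 2) =
          ((2 : ℝ) ^ k * ‖z‖) ^ (γ / 2) * (2 : ℝ) ^ (-γ * i / 2) := by
        rw [zpow_sub₀ (by norm_num), zpow_natCast, div_eq_mul_inv,
          show ‖z‖ * ((2 : ℝ) ^ k * (2 ^ i)⁻¹) = ((2 : ℝ) ^ k * ‖z‖) * (2 ^ i)⁻¹ by ring,
          Real.mul_rpow (by positivity) (by positivity), ← Real.rpow_natCast,
          ← Real.rpow_neg (by norm_num), ← Real.rpow_mul (by norm_num)]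
        congr 2
        ring
      rw [e1, ← mul_assoc]
      gcongr ?_ * _
      have e2 : ((2 : ℝ) ^ k * ‖z‖) ^ (γ / 2) ≤ (1 + (2 : ℝ) ^ k * ‖z‖) ^ (γ / 2) :=
        Real.rpow_le_rpow (by positivity) (by linarith) (by linarith)
      have e3 : (1 + (2 : ℝ) ^ k * ‖z‖) ^ (-((n : ℝ) + γ)) * (1 + (2 : ℝ) ^ k * ‖z‖) ^ (γ / 2) =
          (1 + (2 : ℝ) ^ k * ‖z‖) ^ (-((n : ℝ) + γ / 2)) := by
        rw [← Real.rpow_add (by positivity)]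
        congr 1; ring
      unfold decay
      rw [mul_assoc, ← e3]
      gcongr
    calc ENNReal.ofReal (decay ((n : ℝ) + γ) k z) *
          (8 * n * ENNReal.ofReal ((‖z‖ * (2 : ℝ) ^ (k - i)) ^ (γ / 2)) * sqNorm h)
        = ENNReal.ofReal (decay ((n : ℝ) + γ) k z * (‖z‖ * (2 : ℝ) ^ (k - i)) ^ (γ / 2)) *
          (8 * n * sqNorm h) := by
          rw [ENNReal.ofReal_mul (decay_nonneg _ _ _)]; ring
      _ ≤ ENNReal.ofReal (decay ((n : ℝ) + γ / 2) k z * (2 : ℝ) ^ (-γ * i / 2)) *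
          (8 * n * sqNorm h) := by gcongr
      _ = _ := by rw [ENNReal.ofReal_mul (decay_nonneg _ _ _)]; ring
  refine (lintegral_mono hz).trans (le_of_eq ?_)
  rw [lintegral_mul_const _ (measurable_decay _ k).ennreal_ofReal]
  ring

/-! ### Martingale decomposition of the bilinear form -/

theorem exists_ne_zero_of_dyadicExp_ne_zero {g : Space n → ℂ} {j : ℤ} {x : Space n}
    (h : dyadicExp g j x ≠ 0) : ∃ x', cubeIndex j x' = cubeIndex j x ∧ g x' ≠ 0 := by
  by_contra! hc
  apply h
  rw [dyadicExp, setAverage_eq, setIntegral_congr_fun (g := fun _ => 0) (measurableSet_cube j _)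
    fun y hy => hc y (cubeIndex_of_mem hy)]
  simp

/-- Averaging at generation j ≥ k spreads the support only inside cubes of generation k, and `Far k`
depends only on those cubes. -/
theorem Separated.dyadicExp {k j : ℤ} (hkj : k ≤ j) {F g : Space n → ℂ} (h : Separated k F g) :
    Separated k F (dyadicExp g j) := by
  intro x y hy hx
  obtain ⟨x', h1, h2⟩ := exists_ne_zero_of_dyadicExp_ne_zero hx
  exact (h x' y hy h2).congr_left (cubeIndex_eq_of_le hkj h1)

theorem Separated.dyadicDiff {k j : ℤ} (hkj : k < j) {F g : Space n → ℂ} (h : Separated k F g) :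
    Separated k F (dyadicDiff g j) := by
  intro x y hy hx
  by_cases h1 : PseudoLoc.dyadicExp g j x = 0
  · refine (h.dyadicExp (j := j - 1) (by omega)) x y hy fun h2 => hx ?_
    rw [PseudoLoc.dyadicDiff, h1, h2, sub_zero]
  · exact h.dyadicExp hkj.le x y hy h1

theorem sum_range_dyadicDiff (g : Space n → ℂ) (k : ℤ) (d : ℕ) (x : Space n) :
    ∑ m ∈ Finset.range d, dyadicDiff g (k + (m + 1 : ℕ)) x =
      dyadicExp g (k + d) x - dyadicExp g k x := by
  induction d with
  | zero => simp
  | succ d ih =>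
    rw [Finset.sum_range_succ, ih, dyadicDiff]
    have : k + ((d + 1 : ℕ) : ℤ) - 1 = k + d := by push_cast; ring
    rw [this]
    ring

theorem sum_range_dyadicDiff_sub (g : Space n → ℂ) (k : ℤ) (d : ℕ) (x : Space n) :
    ∑ i ∈ Finset.range d, dyadicDiff g (k - i) x = dyadicExp g k x - dyadicExp g (k - d) x := by
  induction d with
  | zero => simp
  | succ d ih =>
    rw [Finset.sum_range_succ, ih, dyadicDiff]
    have : k - ((d + 1 : ℕ) : ℤ) = k - d - 1 := by push_cast; ring
    rw [this]
    ring

theorem enorm_dyadicExp_sub_le_tsum (hn : 1 ≤ n) {g : Space n → ℂ} (hg : MemLp g 2) (k : ℤ)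
    (x y : Space n) : ‖dyadicExp g k x - dyadicExp g k y‖ₑ ≤
      ∑' i : ℕ, ‖dyadicDiff g (k - i) x - dyadicDiff g (k - i) y‖ₑ := by
  set S := ∑' i : ℕ, ‖dyadicDiff g (k - i) x - dyadicDiff g (k - i) y‖ₑ
  have hlim : Tendsto (fun M : ℕ => S + (‖dyadicExp g (k - M) x‖ₑ + ‖dyadicExp g (k - M) y‖ₑ))
      atTop (𝓝 S) := by
    simpa using tendsto_const_nhds.add
      ((tendsto_dyadicExp_bot hn hg k x).add (tendsto_dyadicExp_bot hn hg k y))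
  refine ge_of_tendsto' hlim fun M => ?_
  have h1 := sum_range_dyadicDiff_sub g k M x
  have h2 := sum_range_dyadicDiff_sub g k M y
  have h3 : dyadicExp g k x - dyadicExp g k y =
      (∑ i ∈ Finset.range M, (dyadicDiff g (k - i) x - dyadicDiff g (k - i) y)) +
        (dyadicExp g (k - M) x - dyadicExp g (k - M) y) := by
    rw [Finset.sum_sub_distrib, h1, h2]; ring
  rw [h3]
  refine (enorm_add_le _ _).trans (add_le_add ?_ enorm_sub_le)
  exact (enorm_sum_le _ _).trans (ENNReal.sum_le_tsum _)

/-- The estimate for the coarse part g_k: it trades |g_k(x)|, not square summable in k, for the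
norms of the dg_{k-i} with geometric weights. -/
theorem weightForm_dyadicExp_le (hn : 1 ≤ n) {γ : ℝ} (hγ0 : 0 < γ) (hγ1 : γ ≤ 1) {t : ℝ≥0∞}
    (ht0 : t ≠ 0) (ht : t ≠ ⊤) {k : ℤ} {F g : Space n → ℂ} (hFm : Measurable F) (hg : MemLp g 2)
    (hs : Separated k F g) :
    weightForm ((n : ℝ) + γ) k (fun y => ‖F y‖ₑ) (fun x => ‖dyadicExp g k x‖ₑ) ≤
      ∑' i : ℕ, ENNReal.ofReal ((2 : ℝ) ^ (-γ * i / 4)) *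
        (decayMass n ((n : ℝ) + γ) * (t * sqNorm F) +
          8 * n * decayMass n ((n : ℝ) + γ / 2) * (t⁻¹ * sqNorm (dyadicDiff g (k - i)))) := by
  set r := (n : ℝ) + γ
  set D : ℕ → Space n → Space n → ℝ≥0∞ := fun i x y =>
    ‖dyadicDiff g (k - i) x - dyadicDiff g (k - i) y‖ₑ with hDdef
  have hD : ∀ i, Measurable fun p : Space n × Space n => D i p.1 p.2 := fun i =>
    (((cubeConst_dyadicDiff g (k - i)).measurable.comp measurable_fst).sub
      ((cubeConst_dyadicDiff g (k - i)).measurable.comp measurable_snd)).enorm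
  have hm : ∀ i, Measurable fun p : Space n × Space n =>
      ENNReal.ofReal (decay r k (p.1 - p.2)) * (‖F p.2‖ₑ * D i p.1 p.2) := fun i =>
    (measurable_decay_sub r k).mul ((hFm.enorm.comp measurable_snd).mul (hD i))
  have hDx : ∀ i x, Measurable fun y => D i x y := fun i x =>
    ((cubeConst_dyadicDiff g (k - i)).measurable.const_sub _).enorm
  have hmx : ∀ i x, Measurable fun y =>
      ENNReal.ofReal (decay r k (x - y)) * (‖F y‖ₑ * D i x y) := fun i x =>
    (measurable_decay_const_sub r k x).mul (hFm.enorm.mul (hDx i x))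
  calc weightForm r k (fun y => ‖F y‖ₑ) (fun x => ‖dyadicExp g k x‖ₑ)
      ≤ ∫⁻ x, ∫⁻ y, ∑' i : ℕ, ENNReal.ofReal (decay r k (x - y)) * (‖F y‖ₑ * D i x y) := by
        refine lintegral_mono fun x => lintegral_mono fun y => ?_
        simp only
        rw [ENNReal.tsum_mul_left, ENNReal.tsum_mul_left]
        refine mul_le_mul_right ?_ _
        by_cases hy : F y = 0
        · simp [hy]
        refine mul_le_mul_right ?_ _
        -- Separation at generation k forces g_k to vanish where F does not, so g_k(x) equals g_k(x)
        -- - g_k(y).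
        have h0 : dyadicExp g k y = 0 := by
          by_contra hne
          exact (hs.dyadicExp le_rfl y y hy hne).ne_index rfl
        simpa [h0] using enorm_dyadicExp_sub_le_tsum hn hg k x y
    _ = ∑' i : ℕ, ∫⁻ x, ∫⁻ y, ENNReal.ofReal (decay r k (x - y)) * (‖F y‖ₑ * D i x y) := by
        rw [← lintegral_tsum fun i => (hm i).lintegral_prod_right'.aemeasurable]
        refine lintegral_congr fun x => ?_
        rw [lintegral_tsum fun i => (hmx i x).aemeasurable]
    _ ≤ _ := by
        refine ENNReal.tsum_le_tsum fun i => ?_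
        set b := ENNReal.ofReal ((2 : ℝ) ^ (-γ * i / 4)) with hb
        have hb0 : b ≠ 0 := by rw [hb, Ne, ENNReal.ofReal_eq_zero, not_le]; positivity
        have hbt : b ≠ ⊤ := ENNReal.ofReal_ne_top
        have hbb : ENNReal.ofReal ((2 : ℝ) ^ (-γ * i / 2)) = b * b := by
          rw [hb, ← ENNReal.ofReal_mul (by positivity), ← Real.rpow_add (by norm_num)]
          congr 2; ring
        -- The parameter t·b, with b² the gain of `lintegral_decay_sq_sub_le`, shares that gain:
        -- both terms end up with the summable factor b.
        refine (lintegral_lintegral_decay_mul_le (t := t * b) (mul_ne_zero ht0 hb0)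
          (ENNReal.mul_ne_top ht hbt) r k hFm.enorm (hD i)).trans ?_
        rw [mul_add]
        refine add_le_add (le_of_eq ?_) ?_
        · rw [sqNorm]; ring
        · refine (mul_le_mul_right (lintegral_decay_sq_sub_le hγ0 hγ1 k i
            (cubeConst_dyadicDiff g (k - i))) _).trans (le_of_eq ?_)
          rw [ENNReal.mul_inv (Or.inl ht0) (Or.inl ht), hbb]
          calc _ = (b⁻¹ * b) * (b * (8 * n * decayMass n ((n : ℝ) + γ / 2) *
                (t⁻¹ * sqNorm (dyadicDiff g (k - i))))) := by ring
            _ = _ := by rw [ENNReal.inv_mul_cancel hb0 hbt, one_mul]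

/-- The sum of the geometric series governing the decay between scales. -/
def scaleSum (γ : ℝ) : ℝ≥0∞ := ∑' i : ℕ, ENNReal.ofReal ((2 : ℝ) ^ (-γ * i / 4))

theorem scaleSum_lt_top {γ : ℝ} (hγ : 0 < γ) : scaleSum γ < ⊤ := by
  have h : ∀ i : ℕ, (2 : ℝ) ^ (-γ * i / 4) = ((2 : ℝ) ^ (-γ / 4)) ^ i := by
    intro i
    rw [← Real.rpow_natCast, ← Real.rpow_mul (by norm_num)]
    congr 1; ring
  have hs : Summable fun i : ℕ => (2 : ℝ) ^ (-γ * i / 4) := by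
    simp only [h]
    refine summable_geometric_of_lt_one (by positivity) ?_
    exact Real.rpow_lt_one_of_one_lt_of_neg (by norm_num) (by linarith)
  rw [scaleSum, ← ENNReal.ofReal_tsum_of_nonneg (fun i => by positivity) hs]
  exact ENNReal.ofReal_lt_top

/-- A constant depending only on the dimension and the smoothness. -/
def massConst (n : ℕ) (γ : ℝ) : ℝ≥0∞ :=
  decayMass n ((n : ℝ) + γ) + 8 * n * decayMass n ((n : ℝ) + γ / 2)

theorem massConst_lt_top {γ : ℝ} (hγ : 0 < γ) : massConst n γ < ⊤ := by
  refine ENNReal.add_lt_top.2 ⟨decayMass_lt_top (by linarith), ENNReal.mul_lt_top ?_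
    (decayMass_lt_top (by linarith))⟩
  exact ENNReal.mul_lt_top (by simp) (by simp)

/-- Fine and coarse parts combined for one k. That g is constant on cubes of generation N makes the
expansion g = g_k + Σ dg_{k+m} finite, so it can be integrated term by term. -/
theorem enorm_pairing_le_tsum (hn : 1 ≤ n) {γ A : ℝ} (hγ0 : 0 < γ) (hγ1 : γ ≤ 1) (hA : 0 ≤ A)
    {K : Space n → Space n → ℂ} (hK : IsCZKernel γ A K)
    (hKm : Measurable fun p : Space n × Space n => K p.1 p.2) {t : ℝ≥0∞} (ht0 : t ≠ 0) (ht : t ≠ ⊤)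
    {k N : ℤ} (hkN : k ≤ N) {s : ℕ} (hs1 : 1 ≤ s) {F g : Space n → ℂ} (hFm : Measurable F)
    (hF : Integrable F) (hF0 : MeanZero (k + s - 1) F) (hg : MemLp g 2) (hgi : Integrable g)
    (hgN : CubeConst N g) (hs : Separated k F g) :
    ‖pairing K F g‖ₑ ≤ ENNReal.ofReal (A * 2 ^ (n + 2) * (2 : ℝ) ^ (-γ * s / 2)) * massConst n γ *
      ∑' i : ℕ, ENNReal.ofReal ((2 : ℝ) ^ (-γ * i / 4)) *
        (2 * (t * sqNorm F) + (t⁻¹ * sqNorm (dyadicDiff g (k + (i + 1 : ℕ))) +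
          t⁻¹ * sqNorm (dyadicDiff g (k - i)))) := by
  obtain ⟨d, rfl⟩ := Int.le.dest hkN
  set C := ENNReal.ofReal (A * 2 ^ (n + 2) * (2 : ℝ) ^ (-γ * s / 2)) with hC
  set a : ℕ → ℝ≥0∞ := fun i => ENNReal.ofReal ((2 : ℝ) ^ (-γ * i / 4)) with ha
  have hdi : ∀ j, Integrable (dyadicDiff g j) := fun j =>
    (integrable_dyadicExp hgi j).sub (integrable_dyadicExp hgi (j - 1))
  have hp : ∀ m : ℕ, Integrable fun p : Space n × Space n =>
      K p.1 p.2 * (F p.2 * dyadicDiff g (k + (m + 1 : ℕ)) p.1) := fun m =>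
    integrable_pairing_of_separated hA hK hKm hF (hdi _) (hs.dyadicDiff (by push_cast; omega))
  have hpe : Integrable fun p : Space n × Space n => K p.1 p.2 * (F p.2 * dyadicExp g k p.1) :=
    integrable_pairing_of_separated hA hK hKm hF (integrable_dyadicExp hgi k) (hs.dyadicExp le_rfl)
  have hsplit : pairing K F g = (∑ m ∈ Finset.range d, pairing K F (dyadicDiff g (k + (m + 1 : ℕ)))) +
      pairing K F (dyadicExp g k) := by
    unfold pairing
    rw [← integral_finsetSum _ fun m _ => hp m, ← integral_add (integrable_finsetSum _ fun m _ => hp m)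
      hpe]
    refine integral_congr_ae (ae_of_all _ fun p => ?_)
    simp only
    rw [← Finset.mul_sum, ← Finset.mul_sum, sum_range_dyadicDiff, dyadicExp_of_cubeConst hgN]
    ring
  have h1 : ∀ m : ℕ, ‖pairing K F (dyadicDiff g (k + (m + 1 : ℕ)))‖ₑ ≤
      C * massConst n γ * (a m * (t * sqNorm F + t⁻¹ * sqNorm (dyadicDiff g (k + (m + 1 : ℕ))))) := by
    intro m
    refine (enorm_pairing_le_of_meanZero_of_meanZero hγ0 hγ1 hA hK hKm (k := k) (m := m + 1) hs1
      (by omega) hFm (cubeConst_dyadicDiff g _).measurable hF (hdi _)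
      (hs.dyadicDiff (by push_cast; omega)) hF0 (meanZero_dyadicDiff hg _)).trans ?_
    have h2 := weightForm_le ht0 ht ((n : ℝ) + γ) k hFm.enorm
      (cubeConst_dyadicDiff g (k + (m + 1 : ℕ))).measurable.enorm
    have h3 : ENNReal.ofReal ((2 : ℝ) ^ (-γ * ((m + 1 : ℕ) : ℝ) / 2)) ≤ a m := by
      refine ENNReal.ofReal_le_ofReal (Real.rpow_le_rpow_of_exponent_le (by norm_num) ?_)
      have : (0 : ℝ) ≤ m := by positivity
      push_cast
      nlinarith
    calc _ ≤ C * a m * (massConst n γ * (t * sqNorm F) +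
            massConst n γ * (t⁻¹ * sqNorm (dyadicDiff g (k + (m + 1 : ℕ))))) := by
          refine mul_le_mul' (mul_le_mul' le_rfl h3) (h2.trans ?_)
          simp only [← sqNorm.eq_1]
          gcongr <;> exact le_self_add
      _ = _ := by ring
  have h2 : ‖pairing K F (dyadicExp g k)‖ₑ ≤ C * massConst n γ *
      ∑' i : ℕ, a i * (t * sqNorm F + t⁻¹ * sqNorm (dyadicDiff g (k - i))) := by
    refine (enorm_pairing_le_of_meanZero hγ0 hγ1 hA hK hKm hs1 hF (integrable_dyadicExp hgi k)
      (hs.dyadicExp le_rfl) hF0).trans ?_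
    rw [mul_assoc C]
    refine mul_le_mul' ?_ ?_
    · rw [hC]
      gcongr ENNReal.ofReal (_ * ?_)
      refine Real.rpow_le_rpow_of_exponent_le (by norm_num) ?_
      have : 0 ≤ γ * s := by positivity
      linarith
    · refine (weightForm_dyadicExp_le hn hγ0 hγ1 ht0 ht hFm hg hs).trans ?_
      rw [← ENNReal.tsum_mul_left]
      refine ENNReal.tsum_le_tsum fun i => ?_
      calc _ ≤ a i * (massConst n γ * (t * sqNorm F) +
            massConst n γ * (t⁻¹ * sqNorm (dyadicDiff g (k - i)))) := by
            gcongr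
            · exact le_self_add
            · exact le_add_self
        _ = _ := by ring
  calc ‖pairing K F g‖ₑ ≤ (∑ m ∈ Finset.range d, ‖pairing K F (dyadicDiff g (k + (m + 1 : ℕ)))‖ₑ) +
        ‖pairing K F (dyadicExp g k)‖ₑ := by
        rw [hsplit]
        exact (enorm_add_le _ _).trans (add_le_add_left (enorm_sum_le _ _) _)
    _ ≤ C * massConst n γ *
          (∑' m : ℕ, a m * (t * sqNorm F + t⁻¹ * sqNorm (dyadicDiff g (k + (m + 1 : ℕ))))) +
        C * massConst n γ *
          ∑' i : ℕ, a i * (t * sqNorm F + t⁻¹ * sqNorm (dyadicDiff g (k - i))) := by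
        gcongr
        rw [← ENNReal.tsum_mul_left]
        exact (Finset.sum_le_sum fun m _ => h1 m).trans (ENNReal.sum_le_tsum _)
    _ = _ := by
        rw [← mul_add, ← ENNReal.tsum_add]
        congr 1
        refine tsum_congr fun i => ?_
        ring

/-- After exchanging the sums over k and i, for each fixed shift i the Bessel inequality bounds the
sum over k of the norms of dg_{k±i} by ‖g‖²; the geometric weights then sum over i. -/
theorem sum_enorm_pairing_le (hn : 1 ≤ n) {γ A : ℝ} (hγ0 : 0 < γ) (hγ1 : γ ≤ 1) (hA : 0 ≤ A)
    {K : Space n → Space n → ℂ} (hK : IsCZKernel γ A K)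
    (hKm : Measurable fun p : Space n × Space n => K p.1 p.2) {t : ℝ≥0∞} (ht0 : t ≠ 0) (ht : t ≠ ⊤)
    {s : ℕ} (hs1 : 1 ≤ s) {N : ℤ} (S : Finset ℤ) (hSN : ∀ k ∈ S, k ≤ N) {F : ℤ → Space n → ℂ}
    {g : Space n → ℂ} (hFm : ∀ k, Measurable (F k)) (hF : ∀ k, Integrable (F k))
    (hF0 : ∀ k, MeanZero (k + s - 1) (F k)) (hg : MemLp g 2) (hgi : Integrable g)
    (hgN : CubeConst N g) (hs : ∀ k ∈ S, Separated k (F k) g) :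
    ∑ k ∈ S, ‖pairing K (F k) g‖ₑ ≤
      ENNReal.ofReal (A * 2 ^ (n + 2) * (2 : ℝ) ^ (-γ * s / 2)) * massConst n γ * (2 * scaleSum γ) *
        (t * (∑' k, sqNorm (F k)) + t⁻¹ * sqNorm g) := by
  set C := ENNReal.ofReal (A * 2 ^ (n + 2) * (2 : ℝ) ^ (-γ * s / 2)) * massConst n γ
  set a : ℕ → ℝ≥0∞ := fun i => ENNReal.ofReal ((2 : ℝ) ^ (-γ * i / 4))
  have hD := tsum_sqNorm_dyadicDiff_le hg
  have e1 : ∀ i : ℕ, ∑' k : ℤ, sqNorm (dyadicDiff g (k + (i + 1 : ℕ))) ≤ sqNorm g := fun i =>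
    ((Equiv.addRight ((i + 1 : ℕ) : ℤ)).tsum_eq fun k => sqNorm (dyadicDiff g k)).le.trans hD
  have e2 : ∀ i : ℕ, ∑' k : ℤ, sqNorm (dyadicDiff g (k - i)) ≤ sqNorm g := fun i =>
    ((Equiv.subRight (i : ℤ)).tsum_eq fun k => sqNorm (dyadicDiff g k)).le.trans hD
  calc ∑ k ∈ S, ‖pairing K (F k) g‖ₑ
      ≤ ∑ k ∈ S, C * ∑' i : ℕ, a i * (2 * (t * sqNorm (F k)) +
        (t⁻¹ * sqNorm (dyadicDiff g (k + (i + 1 : ℕ))) + t⁻¹ * sqNorm (dyadicDiff g (k - i)))) :=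
        Finset.sum_le_sum fun k hk => enorm_pairing_le_tsum hn hγ0 hγ1 hA hK hKm ht0 ht (hSN k hk)
          hs1 (hFm k) (hF k) (hF0 k) hg hgi hgN (hs k hk)
    _ ≤ ∑' k : ℤ, C * ∑' i : ℕ, a i * (2 * (t * sqNorm (F k)) +
        (t⁻¹ * sqNorm (dyadicDiff g (k + (i + 1 : ℕ))) + t⁻¹ * sqNorm (dyadicDiff g (k - i)))) :=
        ENNReal.sum_le_tsum _
    _ = C * ∑' i : ℕ, a i * (2 * (t * ∑' k : ℤ, sqNorm (F k)) +
        (t⁻¹ * (∑' k : ℤ, sqNorm (dyadicDiff g (k + (i + 1 : ℕ)))) +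
          t⁻¹ * ∑' k : ℤ, sqNorm (dyadicDiff g (k - i)))) := by
        rw [ENNReal.tsum_mul_left, ENNReal.tsum_comm]
        simp only [ENNReal.tsum_mul_left, ENNReal.tsum_add]
    _ ≤ C * ∑' i : ℕ, a i * (2 * (t * ∑' k : ℤ, sqNorm (F k)) +
        (t⁻¹ * sqNorm g + t⁻¹ * sqNorm g)) := by
        gcongr with i
        · exact e1 i
        · exact e2 i
    _ = _ := by
        rw [ENNReal.tsum_mul_right, ← scaleSum]
        ring

/-! ### Kernel representation of the operator on separated functions -/

theorem enorm_inner_le_mul (u v : L2 n) : ‖inner ℂ u v‖ₑ ≤ ‖u‖ₑ * ‖v‖ₑ := by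
  simp only [enorm_eq_nnnorm, ← ENNReal.coe_mul]
  exact ENNReal.coe_le_coe.2 (nnnorm_inner_le_nnnorm u v)

theorem integrable_conj {g : Space n → ℂ} (hg : Integrable g) :
    Integrable fun x => starRingEnd ℂ (g x) :=
  hg.mono (Complex.continuous_conj.comp_aestronglyMeasurable hg.1)
    (ae_of_all _ fun x => (RCLike.norm_conj (g x)).le)

theorem enorm_pairing_le_mul {K : Space n → Space n → ℂ} {D G : Space n → ℂ}
    (hD : AEStronglyMeasurable D) (hG : AEStronglyMeasurable G) {C : ℝ}
    (hC : ∀ x y, D y ≠ 0 → G x ≠ 0 → ‖K x y‖ ≤ C) :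
    ‖pairing K D G‖ₑ ≤ ENNReal.ofReal C * ((∫⁻ x, ‖G x‖ₑ) * ∫⁻ y, ‖D y‖ₑ) := by
  refine (enorm_integral_le_lintegral_enorm _).trans ?_
  rw [← lintegral_prod_mul hG.enorm hD.enorm, ← lintegral_const_mul' _ _ ENNReal.ofReal_ne_top]
  refine lintegral_mono fun p => ?_
  rw [enorm_mul, enorm_mul, mul_comm ‖D p.2‖ₑ]
  by_cases h : D p.2 = 0 ∨ G p.1 = 0
  · rcases h with h | h <;> simp [h]
  · push Not at h
    gcongr
    rw [← ofReal_norm]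
    exact ENNReal.ofReal_le_ofReal (hC _ _ h.1 h.2)

theorem IsCZKernel.norm_le_of_le {γ A : ℝ} (hA : 0 ≤ A) {K : Space n → Space n → ℂ}
    (hK : IsCZKernel γ A K) {δ : ℝ} (hδ : 0 < δ) {x y : Space n} (h : δ ≤ ‖x - y‖) :
    ‖K x y‖ ≤ A / δ ^ n := by
  refine (hK.size x y fun he => ?_).trans (by gcongr)
  rw [he, sub_self, norm_zero] at h
  linarith

/-- The inner product is conjugate linear in its first argument while `pairing` is bilinear, whence
the conjugate of g. -/
theorem IsAssociated.inner_eq_pairing_of_contDiff {γ A : ℝ} (hγ : 0 < γ) (hA : 0 ≤ A)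
    {K : Space n → Space n → ℂ} (hK : IsCZKernel γ A K) {T : L2 n →L[ℂ] L2 n}
    (hT : IsAssociated T K) {δ : ℝ} (hδ : 0 < δ) {g φ : Space n → ℂ} (hg : MemLp g 2)
    (hgi : Integrable g) (hφ : ContDiff ℝ ∞ φ) (hc : HasCompactSupport φ)
    (hs : ∀ x y, φ y ≠ 0 → g x ≠ 0 → δ ≤ ‖x - y‖) :
    inner ℂ (hg.toLp g) (T ((hφ.continuous.memLp_of_hasCompactSupport hc : MemLp φ 2).toLp φ)) =
      pairing (offDiag K) φ fun x => starRingEnd ℂ (g x) := by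
  -- A positive distance to {φ ≠ 0} persists on its closure.
  have hts : ∀ x, g x ≠ 0 → x ∉ tsupport φ := by
    intro x hx hmem
    have hcl : IsClosed {y : Space n | δ ≤ ‖x - y‖} :=
      isClosed_le continuous_const (by fun_prop)
    have : x ∈ {y : Space n | δ ≤ ‖x - y‖} :=
      closure_minimal (fun y hy => hs x y hy hx) hcl hmem
    simp only [mem_ofPred_eq, sub_self, norm_zero] at this
    linarith
  have hKC : ∀ x y, φ y ≠ 0 → starRingEnd ℂ (g x) ≠ 0 → ‖offDiag K x y‖ ≤ A / δ ^ n := by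
    intro x y hy hx
    refine hK.offDiag.norm_le_of_le hA hδ (hs x y hy ?_)
    rintro h
    exact hx (by rw [h, map_zero])
  have hi := integrable_pairing (K := offDiag K) (F := φ) (G := fun x => starRingEnd ℂ (g x))
    (hK.measurable_offDiag hγ) (hφ.continuous.integrable_of_hasCompactSupport hc)
    (integrable_conj hgi) hKC
  rw [L2.inner_def, pairing, Measure.volume_eq_prod, integral_prod _ (by
    rwa [← Measure.volume_eq_prod])]
  refine integral_congr_ae ?_
  filter_upwards [hg.coeFn_toLp, hT φ hφ hc] with x hx1 hx2
  rw [hx1, RCLike.inner_apply]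
  by_cases hx : g x = 0
  · simp [hx]
  rw [hx2 (hts x hx), ← integral_mul_const]
  refine integral_congr_ae (ae_of_all _ fun y => ?_)
  simp only
  by_cases hxy : x = y
  · have : φ y = 0 := by
      rw [← hxy]; exact image_eq_zero_of_notMem_tsupport (hts x hx)
    simp [this]
  · rw [offDiag_of_ne hxy, mul_assoc]

open scoped Manifold in
theorem exists_contDiff_cutoff {s t : Set (Space n)} (hs : IsClosed s) (ht : IsClosed t)
    (hd : Disjoint s t) : ∃ η : Space n → ℝ, ContDiff ℝ ∞ η ∧ (∀ x ∈ s, η x = 0) ∧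
      (∀ x ∈ t, η x = 1) ∧ ∀ x, |η x| ≤ 1 := by
  obtain ⟨f, h0, h1, h2⟩ :=
    exists_contMDiffMap_zero_one_of_isClosed (n := (⊤ : ℕ∞)) 𝓘(ℝ, Space n) hs ht hd
  refine ⟨f, f.contMDiff.contDiff, fun x hx => h0 hx, fun x hx => h1 hx, fun x => ?_⟩
  rw [abs_of_nonneg (h2 x).1]
  exact (h2 x).2

/-- Smooth approximations ψ of F may meet the support of g, so they are multiplied by a smooth η
equal to 1 on the support of F and vanishing near that of g and outside a ball. As F = ηF, the
products ηψ still approximate F, and both sides are L_2-continuous on functions supported where η is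
nonzero. -/
theorem IsAssociated.inner_eq_pairing {γ A : ℝ} (hγ : 0 < γ) (hA : 0 ≤ A)
    {K : Space n → Space n → ℂ} (hK : IsCZKernel γ A K) {T : L2 n →L[ℂ] L2 n}
    (hT : IsAssociated T K) {δ R : ℝ} (hδ : 0 < δ) {F g : Space n → ℂ} (hg : MemLp g 2)
    (hgi : Integrable g) (hF : MemLp F 2) (hFR : ∀ y, F y ≠ 0 → ‖y‖ ≤ R)
    (hs : ∀ x y, F y ≠ 0 → g x ≠ 0 → 4 * δ ≤ ‖x - y‖) :
    inner ℂ (hg.toLp g) (T (hF.toLp F)) = pairing (offDiag K) F fun x => starRingEnd ℂ (g x) := by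
  set B := Metric.closedBall (0 : Space n) (R + 1) with hB
  set V := volume B with hV
  have hVt : V ≠ ⊤ := (isCompact_closedBall _ _).measure_ne_top
  obtain ⟨η, hη, hη0, hη1, hηb⟩ := exists_contDiff_cutoff
    (s := Metric.cthickening δ (Function.support g) ∪ {y | R + 1 ≤ ‖y‖})
    (t := {y | ∀ x, g x ≠ 0 → 4 * δ ≤ ‖x - y‖} ∩ {y | ‖y‖ ≤ R})
    (Metric.isClosed_cthickening.union (isClosed_le continuous_const continuous_norm))
    (IsClosed.inter (by
      simp only [ofPred_forall]
      exact isClosed_iInter fun x => isClosed_iInter fun _ =>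
        isClosed_le continuous_const (by fun_prop)) (isClosed_le continuous_norm continuous_const))
    (by
      refine Set.disjoint_left.2 ?_
      rintro y (hy | hy) ⟨hy1, hy2⟩
      · obtain ⟨z, hz, hzy⟩ := Metric.mem_thickening_iff.1
          (Metric.cthickening_subset_thickening' (by linarith : 0 < 2 * δ) (by linarith) _ hy)
        have := hy1 z hz
        rw [dist_comm, dist_eq_norm] at hzy
        linarith
      · simp only [mem_ofPred_eq] at hy hy2
        linarith)
  have hFη : ∀ y, (η y : ℂ) * F y = F y := by
    intro y
    by_cases hy : F y = 0
    · simp [hy]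
    · rw [hη1 y ⟨fun x hx => hs x y hy hx, hFR y hy⟩]; simp
  have hηs : ∀ x y, η y ≠ 0 → g x ≠ 0 → δ ≤ ‖x - y‖ := by
    intro x y hy hx
    by_contra! hlt
    refine hy (hη0 y (Or.inl ?_))
    refine Metric.mem_cthickening_of_dist_le y x δ _ hx ?_
    rw [dist_comm, dist_eq_norm]
    exact hlt.le
  have hηB : ∀ y, η y ≠ 0 → y ∈ B := by
    intro y hy
    by_contra hyB
    rw [hB, mem_closedBall_zero_iff, not_le] at hyB
    exact hy (hη0 y (Or.inr hyB.le))
  set gc : Space n → ℂ := fun x => starRingEnd ℂ (g x)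
  have hgci : Integrable gc := integrable_conj hgi
  set C := A / δ ^ n
  have hKC : ∀ x y, η y ≠ 0 → gc x ≠ 0 → ‖offDiag K x y‖ ≤ C := fun x y hy hx =>
    hK.offDiag.norm_le_of_le hA hδ (hηs x y hy fun h => hx (by simp [gc, h]))
  set M := ‖hg.toLp g‖ₑ * ‖T‖ₑ + ENNReal.ofReal C * ((∫⁻ x, ‖gc x‖ₑ) * V ^ (1 / 2 : ℝ))
  have hM : M ≠ ⊤ := by
    refine ENNReal.add_ne_top.2 ⟨ENNReal.mul_ne_top enorm_ne_top enorm_ne_top,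
      ENNReal.mul_ne_top ENNReal.ofReal_ne_top (ENNReal.mul_ne_top hgci.2.ne ?_)⟩
    exact ENNReal.rpow_ne_top_of_nonneg (by norm_num) hVt
  have key : ∀ ε : ℝ, 0 < ε → ‖inner ℂ (hg.toLp g) (T (hF.toLp F)) - pairing (offDiag K) F gc‖ₑ ≤
      M * ENNReal.ofReal ε := by
    intro ε hε
    obtain ⟨ψ, hψc, hψ, hψε⟩ := hF.exist_eLpNorm_sub_le (by norm_num) (by norm_num) hε
    set φ : Space n → ℂ := fun y => (η y : ℂ) * ψ y with hφdef
    have hφ : ContDiff ℝ ∞ φ := (Complex.ofRealCLM.contDiff.comp hη).mul hψ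
    have hφc : HasCompactSupport φ := hψc.mul_left
    have hφ2 : MemLp φ 2 := hφ.continuous.memLp_of_hasCompactSupport hφc
    have hφη : ∀ y, φ y ≠ 0 → η y ≠ 0 := fun y hy h => hy (by simp [hφdef, h])
    have hrep := hT.inner_eq_pairing_of_contDiff hγ hA hK hδ hg hgi hφ hφc
      fun x y hy hx => hηs x y (hφη y hy) hx
    have hDle : ∀ y, ‖(F - φ) y‖ ≤ ‖(F - ψ) y‖ := by
      intro y
      have : (F - φ) y = (η y : ℂ) * (F - ψ) y := by
        simp only [Pi.sub_apply, hφdef, mul_sub, hFη]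
      rw [this, norm_mul, Complex.norm_real]
      exact mul_le_of_le_one_left (norm_nonneg _) (hηb y)
    have hDε : eLpNorm (F - φ) 2 ≤ ENNReal.ofReal ε := (eLpNorm_mono hDle).trans hψε
    have hDη : ∀ y, (F - φ) y ≠ 0 → η y ≠ 0 := by
      intro y hy h
      apply hy
      have : F y = 0 := by rw [← hFη y, h]; simp
      simp [hφdef, h, this]
    have hDB : Function.support (F - φ) ⊆ B := fun y hy => hηB y (hDη y hy)
    -- The kernel is bounded on the supports in play, so the pairing is controlled by L_1 norms;
    -- Cauchy–Schwarz on the ball returns to L_2.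
    have hD1 : eLpNorm (F - φ) 1 ≤ V ^ (1 / 2 : ℝ) * ENNReal.ofReal ε := by
      rw [← eLpNorm_restrict_eq_of_support_subset hDB]
      refine (eLpNorm_le_eLpNorm_mul_rpow_measure_univ (q := 2) (by norm_num)
        (hF.1.sub hφ2.1).restrict).trans ?_
      rw [eLpNorm_restrict_eq_of_support_subset hDB, mul_comm, Measure.restrict_apply_univ]
      refine mul_le_mul' (le_of_eq ?_) hDε
      congr 1
      norm_num
    have hF1 : Integrable F := by
      have hsub : Function.support F ⊆ B := fun y hy => hηB y fun h => hy (by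
        rw [← hFη y, h]; simp)
      have : IsFiniteMeasure (volume.restrict B) := ⟨by simpa using hVt.lt_top⟩
      exact (integrableOn_iff_integrable_of_support_subset hsub).1
        ((hF.restrict B).integrable (by norm_num))
    have hφ1 : Integrable φ := hφ.continuous.integrable_of_hasCompactSupport hφc
    have hsub : pairing (offDiag K) F gc - pairing (offDiag K) φ gc =
        pairing (offDiag K) (F - φ) gc := by
      unfold pairing
      rw [← integral_sub (integrable_pairing (hK.measurable_offDiag hγ) hF1 hgci
          fun x y hy => hKC x y fun h => hy (by rw [← hFη y, h]; simp))
        (integrable_pairing (hK.measurable_offDiag hγ) hφ1 hgci fun x y hy => hKC x y (hφη y hy))]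
      refine integral_congr_ae (ae_of_all _ fun p => ?_)
      simp only [Pi.sub_apply]
      ring
    have e1 : inner ℂ (hg.toLp g) (T (hF.toLp F)) - pairing (offDiag K) F gc =
        inner ℂ (hg.toLp g) (T ((hF.sub hφ2).toLp (F - φ))) - pairing (offDiag K) (F - φ) gc := by
      rw [MemLp.toLp_sub hF hφ2, map_sub, inner_sub_right, hrep, ← hsub]
      ring
    rw [e1]
    refine enorm_sub_le.trans ?_
    rw [add_mul]
    refine add_le_add ?_ ?_
    · refine (enorm_inner_le_mul _ _).trans ?_
      rw [mul_assoc]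
      gcongr
      refine (T.le_opENorm _).trans ?_
      gcongr
      rwa [Lp.enorm_toLp]
    · refine (enorm_pairing_le_mul (hF.1.sub hφ2.1) hgci.1 fun x y hy hx =>
        hKC x y (hDη y hy) hx).trans ?_
      rw [mul_assoc, mul_assoc]
      gcongr
      rwa [eLpNorm_one_eq_lintegral_enorm] at hD1
  have hlim : Tendsto (fun ε : ℝ => M * ENNReal.ofReal ε) (𝓝[>] 0) (𝓝 0) := by
    have h1 : Tendsto (fun ε : ℝ => ENNReal.ofReal ε) (𝓝[>] 0) (𝓝 0) := by
      have := (ENNReal.continuous_ofReal.tendsto 0).mono_left (nhdsWithin_le_nhds (s := Ioi 0))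
      simpa using this
    simpa using ENNReal.Tendsto.const_mul h1 (Or.inr hM)
  have h0 : ‖inner ℂ (hg.toLp g) (T (hF.toLp F)) - pairing (offDiag K) F gc‖ₑ ≤ 0 :=
    ge_of_tendsto hlim (by filter_upwards [self_mem_nhdsWithin] with ε hε using key ε hε)
  exact sub_eq_zero.1 (enorm_eq_zero.1 (le_antisymm h0 zero_le))

/-! ### Passage to the limit -/

theorem tendsto_toLp_of_sqNorm {f : Space n → ℂ} {u : ℕ → Space n → ℂ} (hf : MemLp f 2)
    (hu : ∀ M, MemLp (u M) 2) (h : Tendsto (fun M => sqNorm fun x => f x - u M x) atTop (𝓝 0)) :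
    Tendsto (fun M => (hu M).toLp (u M)) atTop (𝓝 (hf.toLp f)) := by
  rw [Lp.tendsto_Lp_iff_tendsto_eLpNorm'']
  have h3 := ((ENNReal.continuous_rpow_const (y := 1 / 2)).tendsto 0).comp h
  have h4 : ∀ a : ℝ≥0∞, (a ^ 2) ^ (1 / 2 : ℝ) = a := by
    intro a
    rw [← ENNReal.rpow_natCast, ← ENNReal.rpow_mul]
    norm_num
  simp only [Function.comp_def, sqNorm_eq_eLpNorm_sq, h4,
    ENNReal.zero_rpow_of_pos (by norm_num : (0 : ℝ) < 1 / 2)] at h3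
  refine h3.congr fun M => ?_
  rw [eLpNorm_sub_comm]
  rfl

theorem tendsto_sqNorm_sub_indicator {f : Space n → ℂ} (hf : MemLp f 2) {S : ℕ → Set (Space n)}
    (hS : ∀ M, MeasurableSet (S M)) (hx : ∀ x, ∀ᶠ M in atTop, x ∈ S M) :
    Tendsto (fun M => sqNorm fun x => f x - (S M).indicator f x) atTop (𝓝 0) := by
  have h := tendsto_lintegral_of_dominated_convergence' (μ := (volume : Measure (Space n)))
    (F := fun M x => ‖f x - (S M).indicator f x‖ₑ ^ 2) (f := fun _ => 0) (fun x => ‖f x‖ₑ ^ 2)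
    (fun M => (hf.1.sub (hf.1.indicator (hS M))).enorm.pow_const 2)
    (fun M => ae_of_all _ fun x => by
      by_cases h : x ∈ S M <;> simp [h]) (memLp_two_iff.1 hf).2.ne
    (ae_of_all _ fun x => tendsto_const_nhds.congr' (by
      filter_upwards [hx x] with M hM
      simp [hM]))
  simpa [sqNorm] using h

theorem sqNorm_indicator_le (f : Space n → ℂ) (S : Set (Space n)) :
    sqNorm (S.indicator f) ≤ sqNorm f := by
  refine lintegral_mono fun x => ?_
  by_cases h : x ∈ S <;> simp [h]

/-- The part of `F` on the dyadic cubes of generation `q` whose lower corner lies in the ball of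
radius `M`. -/
def cutoff (q : ℤ) (F : Space n → ℂ) (M : ℕ) : Space n → ℂ := {y | ‖corner q y‖ ≤ M}.indicator F

theorem measurableSet_corner_le (q : ℤ) (M : ℕ) : MeasurableSet {y : Space n | ‖corner q y‖ ≤ M} :=
  measurableSet_le (measurable_corner q).norm measurable_const

/-- Truncating along whole cubes, rather than along a ball, preserves the cancellation. -/
theorem MeanZero.cutoff {q : ℤ} {F : Space n → ℂ} (hF : MeanZero q F) (M : ℕ) :
    MeanZero q (cutoff q F M) := by
  have h := hF.mul (CubeConst.comp_corner q
    ({z : Space n | ‖z‖ ≤ M}.indicator fun _ => (1 : ℂ)))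
  convert h using 2 with y
  by_cases hy : ‖corner q y‖ ≤ M <;> simp [PseudoLoc.cutoff, indicator, hy]

theorem norm_le_of_cutoff_ne_zero {q : ℤ} {F : Space n → ℂ} {M : ℕ} {y : Space n}
    (h : cutoff q F M y ≠ 0) : ‖y‖ ≤ M + (2 : ℝ) ^ (-q) := by
  have h1 : ‖corner q y‖ ≤ M := by
    by_contra hc
    exact h (indicator_of_notMem (by exact hc) _)
  have h2 := norm_sub_corner_le q y
  have h3 := norm_add_le (y - corner q y) (corner q y)
  rw [sub_add_cancel] at h3
  linarith

theorem integrable_of_bounded_support {F : Space n → ℂ} (hF : MemLp F 2) {R : ℝ}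
    (h : ∀ y, F y ≠ 0 → ‖y‖ ≤ R) : Integrable F := by
  have hsub : Function.support F ⊆ Metric.closedBall 0 R := fun y hy =>
    mem_closedBall_zero_iff.2 (h y hy)
  have : IsFiniteMeasure (volume.restrict (Metric.closedBall (0 : Space n) R)) :=
    ⟨by simpa using (isCompact_closedBall (0 : Space n) R).measure_lt_top⟩
  exact (integrableOn_iff_integrable_of_support_subset hsub).1
    ((hF.restrict _).integrable (by norm_num))

theorem Separated.mono {k : ℤ} {F F' G G' : Space n → ℂ} (h : Separated k F G)
    (hF : ∀ y, F' y ≠ 0 → F y ≠ 0) (hG : ∀ x, G' x ≠ 0 → G x ≠ 0) : Separated k F' G' :=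
  fun x y hy hx => h x y (hF y hy) (hG x hx)

/-- The constant in the almost orthogonality estimate. -/
def boundConst (n : ℕ) (γ A : ℝ) (s : ℕ) : ℝ≥0∞ :=
  ENNReal.ofReal (A * 2 ^ (n + 2) * (2 : ℝ) ^ (-γ * s / 2)) * massConst n γ * (2 * scaleSum γ)

theorem sum_enorm_inner_le (hn : 1 ≤ n) {γ A : ℝ} (hγ0 : 0 < γ) (hγ1 : γ ≤ 1)
    {K : Space n → Space n → ℂ} (hK : IsCZKernel γ A K) {T : L2 n →L[ℂ] L2 n}
    (hT : IsAssociated T K) {t : ℝ≥0∞} (ht0 : t ≠ 0) (ht : t ≠ ⊤) {s : ℕ} (hs1 : 1 ≤ s)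
    (S : Finset ℤ) {F : ℤ → Space n → ℂ} {g : Space n → ℂ} (hFm : ∀ k, Measurable (F k))
    (hF : ∀ k, MemLp (F k) 2) (hF0 : ∀ k, MeanZero (k + s - 1) (F k)) (hg : MemLp g 2)
    (hs : ∀ k, Separated k (F k) g) :
    ∑ k ∈ S, ‖inner ℂ (hg.toLp g) (T ((hF k).toLp (F k)))‖ₑ ≤
      boundConst n γ A s * (t * (∑' k, sqNorm (F k)) + t⁻¹ * sqNorm g) := by
  have hA := hK.const_nonneg hn
  set B : ℕ → Set (Space n) := fun M => Metric.closedBall 0 M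
  have hBm : ∀ M, MeasurableSet (B M) := fun M => measurableSet_closedBall
  have hgB : ∀ M, MemLp ((B M).indicator g) 2 := fun M => hg.indicator (hBm M)
  have hgBi : ∀ M, Integrable ((B M).indicator g) := fun M =>
    integrable_of_bounded_support (hgB M) (R := M) fun y hy => by
      by_contra hc
      exact hy (indicator_of_notMem (by simpa [B] using hc) _)
  -- Truncating and then averaging at generation M makes g integrable and constant on cubes of
  -- generation M, without losing the separation once M ≥ k.
  set u : ℕ → Space n → ℂ := fun M => dyadicExp ((B M).indicator g) M
  have hu : ∀ M, MemLp (u M) 2 := fun M => memLp_dyadicExp (hgB M) M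
  have hui : ∀ M, Integrable (u M) := fun M => integrable_dyadicExp (hgBi M) M
  set v : ℤ → ℕ → Space n → ℂ := fun k M => cutoff (k + s - 1) (F k) M
  have hv : ∀ k M, MemLp (v k M) 2 := fun k M => (hF k).indicator (measurableSet_corner_le _ M)
  have hvm : ∀ k M, Measurable (v k M) := fun k M => (hFm k).indicator (measurableSet_corner_le _ M)
  have hvi : ∀ k M, Integrable (v k M) := fun k M =>
    integrable_of_bounded_support (hv k M) fun y hy => norm_le_of_cutoff_ne_zero hy
  have hlu : Tendsto (fun M => (hu M).toLp (u M)) atTop (𝓝 (hg.toLp g)) := by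
    refine tendsto_toLp_of_sqNorm hg hu ?_
    have h1 := tendsto_sqNorm_sub_dyadicExp hg
    have h2 := tendsto_sqNorm_sub_indicator hg hBm fun x => by
      filter_upwards [eventually_ge_atTop ⌈‖x‖⌉₊] with M hM
      exact mem_closedBall_zero_iff.2 ((Nat.le_ceil _).trans (by exact_mod_cast hM))
    have h3 : Tendsto (fun M : ℕ => 4 * ((sqNorm fun x => g x - dyadicExp g M x) +
        sqNorm fun x => g x - (B M).indicator g x)) atTop (𝓝 0) := by
      simpa using ENNReal.Tendsto.const_mul (h1.add h2) (Or.inr (by norm_num : (4 : ℝ≥0∞) ≠ ⊤))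
    refine tendsto_of_tendsto_of_tendsto_of_le_of_le tendsto_const_nhds h3 (fun _ => zero_le) ?_
    intro M
    have e : (fun x => g x - u M x) = fun x => (g x - dyadicExp g M x) +
        dyadicExp (fun y => g y - (B M).indicator g y) M x := by
      funext x
      rw [dyadicExp_sub hg (hgB M)]
      simp [u]
    simp only [e]
    refine (sqNorm_add_le (hg.sub (memLp_dyadicExp hg M)).1 _).trans ?_
    exact mul_le_mul_right (add_le_add_right (sqNorm_dyadicExp_le (hg.sub (hgB M)).1 _) _) _
  have hlv : ∀ k, Tendsto (fun M => (hv k M).toLp (v k M)) atTop (𝓝 ((hF k).toLp (F k))) := by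
    intro k
    refine tendsto_toLp_of_sqNorm (hF k) (hv k) ?_
    refine tendsto_sqNorm_sub_indicator (hF k) (measurableSet_corner_le _) fun x => ?_
    filter_upwards [eventually_ge_atTop ⌈‖corner (k + s - 1) x‖⌉₊] with M hM
    exact (Nat.le_ceil _).trans (by exact_mod_cast hM)
  have hlim : Tendsto (fun M => ∑ k ∈ S, ‖inner ℂ ((hu M).toLp (u M)) (T ((hv k M).toLp (v k M)))‖ₑ)
      atTop (𝓝 (∑ k ∈ S, ‖inner ℂ (hg.toLp g) (T ((hF k).toLp (F k)))‖ₑ)) :=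
    tendsto_finsetSum _ fun k _ =>
      (continuous_enorm.tendsto _).comp (hlu.inner ((T.continuous.tendsto _).comp (hlv k)))
  refine le_of_tendsto hlim ?_
  -- Only finitely many k occur, so M ≥ k can be arranged for all of them at once.
  obtain ⟨N, hN⟩ : ∃ N : ℕ, ∀ k ∈ S, k ≤ N :=
    ⟨S.sup Int.natAbs, fun k hk => by
      have := Finset.le_sup (f := Int.natAbs) hk
      omega⟩
  filter_upwards [eventually_ge_atTop N] with M hM
  set gc : Space n → ℂ := fun x => starRingEnd ℂ (u M x) with hgcdef
  have hgc0 : ∀ x, gc x ≠ 0 → u M x ≠ 0 := fun x hx h => hx (by simp [hgcdef, h])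
  have hv0 : ∀ k y, v k M y ≠ 0 → F k y ≠ 0 := fun k y hy h =>
    hy (by simp [v, cutoff, indicator, h])
  have hsep : ∀ k ∈ S, Separated k (v k M) (u M) := fun k hk =>
    ((hs k).mono (hv0 k) (fun x hx h => hx (by simp [indicator, h]))).dyadicExp
      ((hN k hk).trans (by exact_mod_cast hM))
  have hrep : ∀ k ∈ S, inner ℂ ((hu M).toLp (u M)) (T ((hv k M).toLp (v k M))) =
      pairing (offDiag K) (v k M) gc := fun k hk =>
    hT.inner_eq_pairing hγ0 hA hK (δ := (2 : ℝ) ^ (-k)) (by positivity) (hu M) (hui M) (hv k M)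
      (fun y hy => norm_le_of_cutoff_ne_zero hy) fun x y hy hx => (hsep k hk x y hy hx).le_norm
  rw [Finset.sum_congr rfl fun k hk => by rw [hrep k hk]]
  have hgcs : sqNorm gc = sqNorm (u M) := by simp [sqNorm, hgcdef]
  refine (sum_enorm_pairing_le (g := gc) hn hγ0 hγ1 hA hK.offDiag (hK.measurable_offDiag hγ0) ht0 ht hs1
    (N := M) S (fun k hk => (hN k hk).trans (by exact_mod_cast hM)) (fun k => hvm k M)
    (fun k => hvi k M) (fun k => (hF0 k).cutoff M) (hu M).star (integrable_conj (hui M))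
    (fun x y hxy => by simp only [gc, u, cubeConst_dyadicExp _ _ x y hxy])
    fun k hk => (hsep k hk).mono (fun _ h => h) hgc0).trans ?_
  change boundConst n γ A s * _ ≤ _
  rw [hgcs]
  gcongr with k
  · exact sqNorm_indicator_le _ _
  · exact (sqNorm_dyadicExp_le (hgB M).1 _).trans (sqNorm_indicator_le _ _)

theorem enorm_inner_le (hn : 1 ≤ n) {γ A : ℝ} (hγ0 : 0 < γ) (hγ1 : γ ≤ 1)
    {K : Space n → Space n → ℂ} (hK : IsCZKernel γ A K) {T : L2 n →L[ℂ] L2 n}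
    (hT : IsAssociated T K) {t : ℝ≥0∞} (ht0 : t ≠ 0) (ht : t ≠ ⊤) {s : ℕ} (hs1 : 1 ≤ s)
    {f g : Space n → ℂ} (hf : MemLp f 2) (hg : MemLp g 2) (hgf : ∀ x ∈ localSet f s, g x = 0) :
    ‖inner ℂ (hg.toLp g) (T (hf.toLp f))‖ₑ ≤
      boundConst n γ A s * (t * sqNorm f + t⁻¹ * sqNorm g) := by
  set e : ℤ → L2 n := fun k => (memLp_dyadicExp hf k).toLp (dyadicExp f k)
  have hde : ∀ k, (memLp_dyadicDiff hf k).toLp (dyadicDiff f k) = e k - e (k - 1) := fun k =>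
    MemLp.toLp_sub (memLp_dyadicExp hf k) (memLp_dyadicExp hf (k - 1))
  have htop : Tendsto (fun M : ℕ => e M) atTop (𝓝 (hf.toLp f)) :=
    tendsto_toLp_of_sqNorm hf (fun M => memLp_dyadicExp hf M) (tendsto_sqNorm_sub_dyadicExp hf)
  have hbot : Tendsto (fun M : ℕ => e (-M)) atTop (𝓝 0) := by
    have := tendsto_toLp_of_sqNorm (f := 0) (MemLp.zero : MemLp (0 : Space n → ℂ) 2)
      (fun M : ℕ => memLp_dyadicExp hf (-M)) (by
        simpa [sqNorm] using tendsto_sqNorm_dyadicExp_bot hn hf)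
    rwa [MemLp.toLp_zero] at this
  have hlim : Tendsto (fun M : ℕ => ‖inner ℂ (hg.toLp g) (T (e M - e (-M)))‖ₑ) atTop
      (𝓝 ‖inner ℂ (hg.toLp g) (T (hf.toLp f))‖ₑ) := by
    have h1 := (T.continuous.tendsto _).comp (htop.sub hbot)
    rw [sub_zero] at h1
    exact (continuous_enorm.tendsto _).comp (tendsto_const_nhds.inner h1)
  refine le_of_tendsto' hlim fun M => ?_
  have hsum := sum_enorm_inner_le hn hγ0 hγ1 hK hT ht0 ht hs1
    -- The difference f_M - f_{-M} is the sum of df_i over -M < i ≤ M; the index k = i - s is the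
    -- scale at which df_i is separated from g.
    ((Finset.Ioc (-M : ℤ) M).map (addRightEmbedding (-s : ℤ))) (F := fun k => dyadicDiff f (k + s))
    (fun k => (cubeConst_dyadicDiff f (k + s)).measurable) (fun k => memLp_dyadicDiff hf (k + s))
    (fun k => meanZero_dyadicDiff hf (k + s)) hg fun k x y hy hx =>
      far_of_notMem_localSet (fun h => hx (hgf x h)) hy
  rw [Finset.sum_map] at hsum
  simp only [addRightEmbedding_apply, neg_add_cancel_right, hde] at hsum
  rw [← sum_Ioc_sub e (by omega : (-M : ℤ) ≤ M), map_sum, inner_sum]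
  refine (enorm_sum_le _ _).trans (hsum.trans ?_)
  have h2 : ∑' k : ℤ, sqNorm (dyadicDiff f (k + s)) ≤ sqNorm f :=
    ((Equiv.addRight (s : ℤ)).tsum_eq fun k => sqNorm (dyadicDiff f k)).le.trans
      (tsum_sqNorm_dyadicDiff_le hf)
  gcongr

/-! ### Duality and the final constant. -/

theorem sqrt_le_of_forall_le {a b C : ℝ} (ha : 0 ≤ a) (hC : 0 ≤ C)
    (h : ∀ t : ℝ, 0 < t → a ≤ C * (t * b + t⁻¹ * a)) : √a ≤ 2 * C * √b := by
  rcases hC.eq_or_lt with rfl | hC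
  · have := h 1 one_pos
    have : a = 0 := by linarith
    simp [this]
  · have h1 := h (2 * C) (by positivity)
    have h2 : C * (2 * C * b + (2 * C)⁻¹ * a) = 2 * C ^ 2 * b + a / 2 := by field_simp
    have h3 : a ≤ (2 * C) ^ 2 * b := by linarith
    calc √a ≤ √((2 * C) ^ 2 * b) := Real.sqrt_le_sqrt h3
      _ = 2 * C * √b := by
        rw [Real.sqrt_mul (by positivity), Real.sqrt_sq (by positivity)]

/-- The test function g is Tf restricted to the complement of Σ, so ⟨g, Tf⟩ is exactly the integral
to be bounded, and g vanishes on Σ as `enorm_inner_le` demands. -/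
theorem sqrt_setIntegral_compl_localSet_le (hn : 1 ≤ n) {γ A : ℝ} (hγ0 : 0 < γ) (hγ1 : γ ≤ 1)
    {K : Space n → Space n → ℂ} (hK : IsCZKernel γ A K) {T : L2 n →L[ℂ] L2 n}
    (hT : IsAssociated T K) {s : ℕ} (hs1 : 1 ≤ s) (f : L2 n) :
    √(∫ x in (localSet f s)ᶜ, ‖T f x‖ ^ 2) ≤
      2 * (boundConst n γ A s).toReal * √(∫ x, ‖f x‖ ^ 2) := by
  have hSm := (measurableSet_localSet (f : Space n → ℂ) s).compl
  set g : Space n → ℂ := (localSet f s)ᶜ.indicator (T f) with hgdef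
  have hf : MemLp (f : Space n → ℂ) 2 := Lp.memLp f
  have hg : MemLp g 2 := (Lp.memLp (T f)).indicator hSm
  have hCt : boundConst n γ A s ≠ ⊤ :=
    ENNReal.mul_ne_top (ENNReal.mul_ne_top ENNReal.ofReal_ne_top (massConst_lt_top hγ0).ne)
      (ENNReal.mul_ne_top (by norm_num) (scaleSum_lt_top hγ0).ne)
  have ha : ∫ x in (localSet f s)ᶜ, ‖T f x‖ ^ 2 = ∫ x, ‖g x‖ ^ 2 := by
    rw [← integral_indicator hSm]
    congr 1
    funext x
    by_cases hx : x ∈ (localSet f s)ᶜ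
    · rw [indicator_of_mem hx, hgdef, indicator_of_mem hx]
    · rw [indicator_of_notMem hx, hgdef, indicator_of_notMem hx]; simp
  have hinner : inner ℂ (hg.toLp g) (T f) = ((∫ x, ‖g x‖ ^ 2 : ℝ) : ℂ) := by
    rw [L2.inner_def, ← integral_complex_ofReal]
    refine integral_congr_ae ?_
    filter_upwards [hg.coeFn_toLp] with x hx
    rw [hx, RCLike.inner_apply]
    by_cases hxs : x ∈ (localSet f s)ᶜ
    · have : g x = T f x := indicator_of_mem hxs _
      rw [← this, RCLike.mul_conj]
      simp
    · have : g x = 0 := indicator_of_notMem hxs _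
      simp [this]
  rw [ha]
  set a := ∫ x, ‖g x‖ ^ 2 with hadef
  set b := ∫ x, ‖f x‖ ^ 2 with hbdef
  have ha0 : 0 ≤ a := integral_nonneg fun x => by positivity
  have hb0 : 0 ≤ b := integral_nonneg fun x => by positivity
  refine sqrt_le_of_forall_le ha0 ENNReal.toReal_nonneg fun t ht => ?_
  have h := enorm_inner_le hn hγ0 hγ1 hK hT (t := ENNReal.ofReal t) (by simpa using ht)
    ENNReal.ofReal_ne_top hs1 hf hg fun x hx => indicator_of_notMem (by simpa using hx) _
  rw [Lp.toLp_coeFn, hinner, sqNorm_eq_ofReal_integral hf, sqNorm_eq_ofReal_integral hg, ← hadef,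
    ← hbdef, ← ENNReal.ofReal_inv_of_pos ht, ← ENNReal.ofReal_mul ht.le,
    ← ENNReal.ofReal_mul (by positivity), ← ENNReal.ofReal_add (by positivity) (by positivity),
    ← ENNReal.ofReal_toReal hCt, ← ENNReal.ofReal_mul ENNReal.toReal_nonneg, ← ofReal_norm,
    Complex.norm_real, Real.norm_eq_abs, abs_of_nonneg ha0] at h
  exact (ENNReal.ofReal_le_ofReal_iff (by positivity)).1 h

end PseudoLoc

end

theorem mainTheorem3 (n : ℕ) (hn : 1 ≤ n) (γ : ℝ) (hγ0 : 0 < γ) (hγ1 : γ ≤ 1) :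
    ∃ c : ℝ, 0 < c ∧
      ∀ (s : ℕ), 1 ≤ s → ∀ (f : PseudoLoc.L2 n) (A : ℝ)
        (K : PseudoLoc.Space n → PseudoLoc.Space n → ℂ)
        (T : PseudoLoc.L2 n →L[ℂ] PseudoLoc.L2 n),
        PseudoLoc.IsCZKernel γ A K → PseudoLoc.IsAssociated T K → ‖T‖ ≤ 1 →
          Real.sqrt (∫ x in (PseudoLoc.localSet f s)ᶜ, ‖T f x‖ ^ 2) ≤
            c * (1 + A) * s * (2 : ℝ) ^ (-(γ * s) / 4) * Real.sqrt (∫ x, ‖f x‖ ^ 2) := by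
  set c₀ := (PseudoLoc.massConst n γ * (2 * PseudoLoc.scaleSum γ)).toReal with hc₀
  have hc₀0 : 0 ≤ c₀ := ENNReal.toReal_nonneg
  -- The power n+3 is the n+2 of the kernel estimate plus one from the optimisation in t; the added
  -- 1 only ensures positivity. The factor A·2^{-γs/2} is then weakened to (1+A)·s·2^{-γs/4}.
  refine ⟨2 ^ (n + 3) * c₀ + 1, by positivity, fun s hs1 f A K T hK hT _ => ?_⟩
  have hA := hK.const_nonneg hn
  refine (PseudoLoc.sqrt_setIntegral_compl_localSet_le hn hγ0 hγ1 hK hT hs1 f).trans ?_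
  gcongr ?_ * _
  have hs1' : (1 : ℝ) ≤ s := by exact_mod_cast hs1
  rw [PseudoLoc.boundConst, mul_assoc (ENNReal.ofReal _), ENNReal.toReal_mul,
    ENNReal.toReal_ofReal (by positivity), ← hc₀]
  have hexp : (2 : ℝ) ^ (-γ * s / 2) ≤ (2 : ℝ) ^ (-(γ * s) / 4) := by
    refine Real.rpow_le_rpow_of_exponent_le (by norm_num) ?_
    have : 0 ≤ γ * s := by positivity
    linarith
  have hA1 : A ≤ 1 + A := by linarith
  calc 2 * (A * 2 ^ (n + 2) * (2 : ℝ) ^ (-γ * s / 2) * c₀)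
      = (2 ^ (n + 3) * c₀ + 0) * A * 1 * (2 : ℝ) ^ (-γ * s / 2) := by ring
    _ ≤ (2 ^ (n + 3) * c₀ + 1) * (1 + A) * s * (2 : ℝ) ^ (-(γ * s) / 4) := by
        gcongr
        norm_num
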